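/- Let $d\ge 1$, let $G$ be a closed subgroup of $\mathrm O(d)$, let $U$ be a real finite-dimensional inner product space and $\theta$ a (continuous) orthogonal representation of $G$ in $U$; if $-I\in G$, assume that $-I$ acts trivially in $U\otimes U$, i.e. $(\theta\otimes\theta)(-I)=\mathrm{id}$ (equivalently $\theta(-I)=\pm\mathrm{id}$). Let $cU=\mathbb C\otimes_{\mathbb R}U$ with the Hermitian form $H(z_1\otimes u_1,z_2\otimes u_2)=z_1^*z_2(u_1,u_2)$ and the conjugation $j(z\otimes u)=z^*\otimes u$. All random fields $T$ on $\mathbb R^d$ are $cU$-valued, of second order, centred and mean-square continuous; $U$-valued fields are regarded as $cU$-valued via $u\mapsto 1\otimes u$. The two-point correlation tensor is $\langle T(x),T(y)\rangle=\mathsf E[jT(x)\otimes T(y)]$, where $jv\otimes w$ is identified with the operator $u\mapsto H(v,u)w$ on $cU$. The field is homogeneous if its mean and $\langle T(x),T(y)\rangle$ are shift-invariant, and isotropic if $\langle T(gx)\rangle=\theta(g)\langle T(x)\rangle$ and $\langle T(gx),T(gy)\rangle=(\theta\otimes\theta)(g)\langle T(x),T(y)\rangle$ for all $g\in G$, where $(\theta\otimes\theta)(g)$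 acts on operators by $C\mapsto\theta(g)C\theta(g)^{-1}$. A countably additive operator-valued Borel measure $F$ on $\hat{\mathbb R}^d=\mathbb R^d$ is the spectral measure of $T$ if $$\langle T(x),T(y)\rangle=\int_{\hat{\mathbb R}^d}e^{\mathrm i(k,y-x)}\,\mathrm dF(k)\qquad\text{for all }x,y.$$ Let $\tilde G=G\cup(-I)G$. Put $\tilde U=\mathsf S^2(U)$ if $-I\in G$, and $\tilde U=U\otimes U$ otherwise. Let $\theta^{\tilde U}$ be the representation of $\tilde G$ in $\tilde U$ in which $g\in G$ acts by $\theta\otimes\theta$ and, if $-I\notin G$, $(-I)g$ acts as $g$ on $\mathsf S^2(U)$ and as $-g$ on $\Lambda^2(U)$. Identify $U\otimes U$ with the real space of Hermitian operators on $cU$: $a\otimes b$ corresponds to the operator $u\mapsto(a,u)b$ of $U$, a symmetric tensor is sent to the complexification of its (symmetric) operator, and a skew-symmetric tensor to $\mathrm i$ times the complexification of its (skew-symmetric) operator. Say that $F$ satisfies (C) if, for all Borel sets $A$, the operator $F(A)$ belongs to the intersection of $\tilde U$ with the cone of Hermitian nonnegative-definite operators on $cU$, and $$F(\tilde gA)=\theta^{\tilde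 U}(\tilde g)F(A)\qquad\text{for all }\tilde g\in\tilde G .$$ Then, for every operator-valued measure $F$ on $\hat{\mathbb R}^d$: 1. $F$ is the spectral measure of some $U$-valued homogeneous and isotropic random field if and only if $F$ satisfies (C). 2. If $T$ is a random field with spectral measure $F$, then $T$ is $U$-valued, homogeneous and isotropic if and only if $F$ satisfies (C). Here "$U$-valued" is understood up to the two-point correlation tensor: some $U$-valued random field has the same two-point correlation tensor as $T$ (in particular this holds if $T$ itself takes values in $U$). -/

import Mathlib

universe u v

open MeasureTheory Filter Topology
open scoped TensorProduct InnerProductSpace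

namespace RandomField

noncomputable section

/-! ### The complexification `cU = ℂ ⊗_ℝ U` of a real inner product space -/

section Complexification

/-- The complexification `cU = ℂ ⊗_ℝ U`. -/
def Complexification (U : Type*) [NormedAddCommGroup U] [InnerProductSpace ℝ U] : Type _ :=
  ℂ ⊗[ℝ] U

variable (U : Type*) [NormedAddCommGroup U] [InnerProductSpace ℝ U]

/-- The norm on `cU` is that of the tensor product of the Euclidean spaces `ℂ` and `U`;
it is the norm of the Hermitian form below. -/
instance : NormedAddCommGroup (Complexification U) :=
  inferInstanceAs (NormedAddCommGroup (ℂ ⊗[ℝ] U))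

instance : Module ℂ (Complexification U) :=
  inferInstanceAs (Module ℂ (ℂ ⊗[ℝ] U))

variable {U}

/-- The elementary tensor `z ⊗ u` of `cU`. -/
def ctmul (z : ℂ) (u : U) : Complexification U := (z ⊗ₜ[ℝ] u : ℂ ⊗[ℝ] U)

/-- The embedding `u ↦ 1 ⊗ u` of `U` in `cU`. -/
def ofReal (u : U) : Complexification U := ctmul 1 u

theorem Complexification.induction {p : Complexification U → Prop} (v : Complexification U)
    (h0 : p 0) (h1 : ∀ z u, p (ctmul z u)) (h2 : ∀ v w, p v → p w → p (v + w)) : p v :=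
  TensorProduct.induction_on (motive := p) v h0 h1 h2

theorem smul_ctmul (a z : ℂ) (u : U) : a • ctmul z u = ctmul (a * z) u := rfl

/-- The real inner product of `ℂ ⊗_ℝ U`. -/
def reInner (v w : Complexification U) : ℝ := @inner ℝ (ℂ ⊗[ℝ] U) _ v w

theorem reInner_add_left (v v' w : Complexification U) :
    reInner (v + v') w = reInner v w + reInner v' w :=
  inner_add_left (𝕜 := ℝ) (E := ℂ ⊗[ℝ] U) v v' w

theorem reInner_add_right (v w w' : Complexification U) :
    reInner v (w + w') = reInner v w + reInner v w' :=
  inner_add_right (𝕜 := ℝ) (E := ℂ ⊗[ℝ] U) v w w'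

theorem reInner_zero_left (w : Complexification U) : reInner 0 w = 0 :=
  inner_zero_left (𝕜 := ℝ) (E := ℂ ⊗[ℝ] U) w

theorem reInner_zero_right (w : Complexification U) : reInner w 0 = 0 :=
  inner_zero_right (𝕜 := ℝ) (E := ℂ ⊗[ℝ] U) w

theorem reInner_ctmul (z z' : ℂ) (u u' : U) :
    reInner (ctmul z u) (ctmul z' u') = ((starRingEnd ℂ) z * z').re * inner ℝ u u' := by
  have h := TensorProduct.inner_tmul ℝ z z' u u'
  rw [Complex.inner, mul_comm z'] at h
  exact h

/-- The Hermitian form `H` on `cU`, conjugate-linear in the first variable; it is determined by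
`H (z₁ ⊗ u₁, z₂ ⊗ u₂) = z₁^* z₂ (u₁, u₂)`, see `hermForm_ctmul`. -/
def hermForm (v w : Complexification U) : ℂ :=
  ⟨reInner v w, -reInner v (Complex.I • w)⟩

theorem hermForm_add_left (v v' w : Complexification U) :
    hermForm (v + v') w = hermForm v w + hermForm v' w := by
  apply Complex.ext
  · simp [hermForm, reInner_add_left]
  · simp [hermForm, reInner_add_left]; ring

theorem hermForm_add_right (v w w' : Complexification U) :
    hermForm v (w + w') = hermForm v w + hermForm v w' := by
  apply Complex.ext
  · simp [hermForm, reInner_add_right]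
  · simp [hermForm, reInner_add_right]; ring

theorem hermForm_zero_left (w : Complexification U) : hermForm 0 w = 0 := by
  apply Complex.ext <;> simp [hermForm, reInner_zero_left]

theorem hermForm_zero_right (w : Complexification U) : hermForm w 0 = 0 := by
  apply Complex.ext <;> simp [hermForm, reInner_zero_right]

theorem hermForm_ctmul (z z' : ℂ) (u u' : U) :
    hermForm (ctmul z u) (ctmul z' u')
      = (starRingEnd ℂ) z * z' * ((inner ℝ u u' : ℝ) : ℂ) := by
  apply Complex.ext
  · simp [hermForm, reInner_ctmul]
  · simp [hermForm, reInner_ctmul, smul_ctmul]; ring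

theorem hermForm_conj_symm (v w : Complexification U) :
    (starRingEnd ℂ) (hermForm w v) = hermForm v w := by
  induction v using Complexification.induction with
  | h0 => simp [hermForm_zero_left, hermForm_zero_right]
  | h2 v v' h h' => simp [hermForm_add_left, hermForm_add_right, h, h']
  | h1 z u =>
    induction w using Complexification.induction with
    | h0 => simp [hermForm_zero_left, hermForm_zero_right]
    | h2 v v' h h' => simp [hermForm_add_left, hermForm_add_right, h, h']
    | h1 z' u' =>
      simp only [hermForm_ctmul, map_mul, Complex.conj_conj, Complex.conj_ofReal,
        real_inner_comm u u']
      ring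

theorem hermForm_smul_left (v w : Complexification U) (a : ℂ) :
    hermForm (a • v) w = (starRingEnd ℂ) a * hermForm v w := by
  induction v using Complexification.induction with
  | h0 => simp [hermForm_zero_left]
  | h2 v v' h h' => simp [hermForm_add_left, h, h', mul_add]
  | h1 z u =>
    induction w using Complexification.induction with
    | h0 => simp [hermForm_zero_right]
    | h2 v v' h h' => simp [hermForm_add_right, h, h', mul_add]
    | h1 z' u' => simp only [smul_ctmul, hermForm_ctmul, map_mul]; ring

theorem norm_sq_eq_hermForm (v : Complexification U) : ‖v‖ ^ 2 = (hermForm v v).re :=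
  (real_inner_self_eq_norm_sq (F := ℂ ⊗[ℝ] U) v).symm

theorem norm_smul_complexification (a : ℂ) (v : Complexification U) : ‖a • v‖ = ‖a‖ * ‖v‖ := by
  have h : ‖a • v‖ ^ 2 = (‖a‖ * ‖v‖) ^ 2 := by
    rw [mul_pow, norm_sq_eq_hermForm, norm_sq_eq_hermForm, hermForm_smul_left,
      ← hermForm_conj_symm, hermForm_smul_left, map_mul, Complex.conj_conj, hermForm_conj_symm,
      ← mul_assoc, mul_comm ((starRingEnd ℂ) a), Complex.mul_conj, Complex.re_ofReal_mul,
      Complex.normSq_eq_norm_sq]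
  exact (sq_eq_sq₀ (norm_nonneg _) (by positivity)).1 h

instance : NormedSpace ℂ (Complexification U) where
  norm_smul_le a v := (norm_smul_complexification a v).le

/-- `cU` with the Hermitian form `H`. -/
instance : InnerProductSpace ℂ (Complexification U) where
  inner v w := hermForm v w
  norm_sq_eq_re_inner v := norm_sq_eq_hermForm v
  conj_inner_symm v w := hermForm_conj_symm v w
  add_left v w z := hermForm_add_left v w z
  smul_left v w a := hermForm_smul_left v w a

instance [FiniteDimensional ℝ U] : FiniteDimensional ℂ (Complexification U) :=
  inferInstanceAs (Module.Finite ℂ (ℂ ⊗[ℝ] U))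

instance : MeasurableSpace (Complexification U) := borel _

instance : BorelSpace (Complexification U) := ⟨rfl⟩

/-- The `ℂ`-linear operator on `cU` extending a linear operator `A` on `U`,
`z ⊗ u ↦ z ⊗ A u`. -/
def complexifyOp [FiniteDimensional ℝ U] :
    (U →ₗ[ℝ] U) →ₗ[ℝ] (Complexification U →L[ℂ] Complexification U) where
  toFun A := LinearMap.toContinuousLinearMap
    (E := Complexification U) (F' := Complexification U) (A.baseChange ℂ)
  map_add' A B := by
    ext v
    induction v using Complexification.induction with
    | h0 => simp
    | h2 v w hv hw => simp only [map_add, hv, hw]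
    | h1 z u => exact TensorProduct.tmul_add z (A u) (B u)
  map_smul' r A := by
    ext v
    induction v using Complexification.induction with
    | h0 => simp
    | h2 v w hv hw => simp only [map_add, hv, hw]
    | h1 z u =>
      change (z ⊗ₜ[ℝ] (r • A u) : ℂ ⊗[ℝ] U) = (r : ℂ) • (z ⊗ₜ[ℝ] A u : ℂ ⊗[ℝ] U)
      rw [TensorProduct.tmul_smul, TensorProduct.smul_tmul', TensorProduct.smul_tmul',
        Complex.real_smul, smul_eq_mul]

theorem complexifyOp_ctmul [FiniteDimensional ℝ U] (A : U →ₗ[ℝ] U) (z : ℂ) (u : U) :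
    complexifyOp A (ctmul z u) = ctmul z (A u) := rfl

end Complexification

/-! ### Rank two tensors over `U` and Hermitian operators on `cU` -/

section Tensors

variable (U : Type*) [NormedAddCommGroup U] [InnerProductSpace ℝ U]

/-- The transposition `a ⊗ b ↦ b ⊗ a` of `U ⊗ U`. -/
def swap : (U ⊗[ℝ] U) →ₗ[ℝ] (U ⊗[ℝ] U) := (TensorProduct.comm ℝ U U).toLinearMap

/-- The space `S²(U)` of symmetric tensors of rank two. -/
def symTensors : Submodule ℝ (U ⊗[ℝ] U) := LinearMap.eqLocus (swap U) LinearMap.id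

/-- The space `Λ²(U)` of skew-symmetric tensors of rank two. -/
def skewTensors : Submodule ℝ (U ⊗[ℝ] U) := LinearMap.eqLocus (swap U) (-LinearMap.id)

/-- The identification of `U ⊗ U` with the operators on `U`: `a ⊗ b` is `u ↦ (a, u) b`. -/
def tensorOp : (U ⊗[ℝ] U) →ₗ[ℝ] (U →ₗ[ℝ] U) :=
  TensorProduct.lift
    (LinearMap.mk₂ ℝ (fun a b : U => (innerₛₗ ℝ a).smulRight b)
      (fun a a' b => by ext u; simp [add_smul])
      (fun r a b => by ext u; simp [mul_smul])
      (fun a b b' => by ext u; simp)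
      (fun r a b => by ext u; exact smul_comm _ _ _))

theorem tensorOp_tmul (a b u : U) : tensorOp U (a ⊗ₜ b) u = (inner ℝ a u : ℝ) • b := by
  simp [tensorOp]

/-- The identification of the real representation `U ⊗ U` with the Hermitian operators on `cU`.
A symmetric tensor is sent to the corresponding (symmetric) operator, extended to `cU`, and a
skew-symmetric tensor to `i` times the corresponding (skew-symmetric) operator; so `S²(U)` and
`Λ²(U)` become the `+1` and `-1` eigenspaces, among the Hermitian operators, of the real
structure `F ↦ j F j⁻¹`, where `j` is the conjugation of `cU`. -/
def hermOp [FiniteDimensional ℝ U] (t : U ⊗[ℝ] U) :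
    Complexification U →L[ℂ] Complexification U :=
  (1 / 2 : ℂ) • complexifyOp (tensorOp U (t + swap U t))
    + (Complex.I / 2) • complexifyOp (tensorOp U (t - swap U t))

variable {U}

theorem swap_swap (t : U ⊗[ℝ] U) : swap U (swap U t) = t := by
  induction t using TensorProduct.induction_on with
  | zero => simp
  | tmul a b => rfl
  | add x y hx hy => simp only [map_add, hx, hy]

theorem swap_map (A : U →ₗ[ℝ] U) (t : U ⊗[ℝ] U) :
    swap U (TensorProduct.map A A t) = TensorProduct.map A A (swap U t) := by
  induction t using TensorProduct.induction_on with
  | zero => simp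
  | tmul a b => rfl
  | add x y hx hy => simp only [map_add, hx, hy]

end Tensors

/-! ### The group `G̃`, the space `Ũ` and the representation `θ^Ũ` -/

section Group

variable {d : ℕ}

/-- The group `O(d)`. -/
abbrev Orth (d : ℕ) : Type := Matrix.orthogonalGroup (Fin d) ℝ

/-- The space domain, and also the wavenumber domain. -/
abbrev Space (d : ℕ) : Type := EuclideanSpace ℝ (Fin d)

/-- The action of `O(d)` on `ℝ^d`. -/
def rot (g : Orth d) : Space d →ₗ[ℝ] Space d := Matrix.toEuclideanLin (g : Matrix (Fin d) (Fin d) ℝ)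

/-- `G̃ = G ∪ {(-I) g : g ∈ G}`. -/
def tildeG (G : Subgroup (Orth d)) : Subgroup (Orth d) where
  carrier := {g | g ∈ G ∨ ∃ h ∈ G, g = (-1) * h}
  one_mem' := Or.inl G.one_mem
  mul_mem' := by
    rintro a b (ha | ⟨a', ha, rfl⟩) (hb | ⟨b', hb, rfl⟩)
    · exact Or.inl (G.mul_mem ha hb)
    · exact Or.inr ⟨a * b', G.mul_mem ha hb, by simp⟩
    · exact Or.inr ⟨a' * b, G.mul_mem ha hb, by simp⟩
    · exact Or.inl (by simpa using G.mul_mem ha hb)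
  inv_mem' := by
    rintro a (ha | ⟨a', ha, rfl⟩)
    · exact Or.inl (G.inv_mem ha)
    · refine Or.inr ⟨a'⁻¹, G.inv_mem ha, ?_⟩
      rw [inv_eq_iff_mul_eq_one]
      simp

theorem neg_mem_of_mem_tildeG {G : Subgroup (Orth d)} {g : Orth d} (hg : g ∈ tildeG G)
    (h : g ∉ G) : -g ∈ G := by
  rcases hg with hg | ⟨k, hk, rfl⟩
  · exact absurd hg h
  · simpa using hk

variable (U : Type*) [NormedAddCommGroup U] [InnerProductSpace ℝ U]

open Classical in
/-- `Ũ` is `S²(U)` if `-I ∈ G`, and `U ⊗ U` otherwise. -/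
def tildeU (G : Subgroup (Orth d)) : Submodule ℝ (U ⊗[ℝ] U) :=
  if (-1 : Orth d) ∈ G then symTensors U else ⊤

variable {U} {G : Subgroup (Orth d)} (θ : G →* (U ≃ₗᵢ[ℝ] U))

/-- The representation `θ ⊗ θ` of `G` in `U ⊗ U`. -/
def tensorSq (g : G) : (U ⊗[ℝ] U) →ₗ[ℝ] (U ⊗[ℝ] U) :=
  TensorProduct.map (θ g).toLinearEquiv.toLinearMap (θ g).toLinearEquiv.toLinearMap

theorem tensorSq_one : tensorSq θ 1 = LinearMap.id := by
  ext a b; simp [tensorSq]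

theorem tensorSq_mul (g h : G) (t : U ⊗[ℝ] U) :
    tensorSq θ (g * h) t = tensorSq θ g (tensorSq θ h t) := by
  induction t using TensorProduct.induction_on with
  | zero => simp
  | tmul a b => simp [tensorSq]
  | add x y hx hy => simp only [map_add, hx, hy]

theorem swap_tensorSq (g : G) (t : U ⊗[ℝ] U) :
    swap U (tensorSq θ g t) = tensorSq θ g (swap U t) := swap_map _ t

open Classical in
/-- The action of `G̃` on `U ⊗ U`: an element `g ∈ G` acts by `θ ⊗ θ`, and for `g ∈ G` the element
`(-I) g ∉ G` acts as `g` on `S²(U)` and as `-g` on `Λ²(U)`, that is, as `g` composed with the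
transposition; see `tildeAct_sym` and `tildeAct_skew`. -/
def tildeAct (g : tildeG G) : (U ⊗[ℝ] U) →ₗ[ℝ] (U ⊗[ℝ] U) :=
  if h : (g : Orth d) ∈ G then tensorSq θ ⟨g, h⟩
  else (tensorSq θ ⟨-g, neg_mem_of_mem_tildeG g.2 h⟩) ∘ₗ swap U

theorem tildeAct_of_mem {g : tildeG G} (h : (g : Orth d) ∈ G) :
    tildeAct θ g = tensorSq θ ⟨g, h⟩ := by simp [tildeAct, h]

theorem tildeAct_of_notMem {g : tildeG G} (h : (g : Orth d) ∉ G) :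
    tildeAct θ g = (tensorSq θ ⟨-g, neg_mem_of_mem_tildeG g.2 h⟩) ∘ₗ swap U := by
  simp [tildeAct, h]

theorem tildeAct_sym {g : tildeG G} (h : (g : Orth d) ∉ G) (t : U ⊗[ℝ] U)
    (ht : t ∈ symTensors U) :
    tildeAct θ g t = tensorSq θ ⟨-g, neg_mem_of_mem_tildeG g.2 h⟩ t := by
  have ht' : swap U t = t := ht
  rw [tildeAct_of_notMem θ h, LinearMap.comp_apply, ht']

theorem tildeAct_skew {g : tildeG G} (h : (g : Orth d) ∉ G) (t : U ⊗[ℝ] U)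
    (ht : t ∈ skewTensors U) :
    tildeAct θ g t = -tensorSq θ ⟨-g, neg_mem_of_mem_tildeG g.2 h⟩ t := by
  have ht' : swap U t = -t := ht
  rw [tildeAct_of_notMem θ h, LinearMap.comp_apply, ht', map_neg]

theorem tildeAct_one : tildeAct θ (1 : tildeG G) = LinearMap.id := by
  rw [tildeAct_of_mem θ (g := 1) G.one_mem]
  exact tensorSq_one θ

theorem tildeAct_mul (g h : tildeG G) (t : U ⊗[ℝ] U) :
    tildeAct θ (g * h) t = tildeAct θ g (tildeAct θ h t) := by
  by_cases hg : (g : Orth d) ∈ G <;> by_cases hh : (h : Orth d) ∈ G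
  · rw [tildeAct_of_mem θ hg, tildeAct_of_mem θ hh, ← tensorSq_mul,
      tildeAct_of_mem θ (g := g * h) (G.mul_mem hg hh)]
    rfl
  · have hgh : ((g * h : tildeG G) : Orth d) ∉ G := fun H => hh ((G.mul_mem_cancel_left hg).1 H)
    rw [tildeAct_of_mem θ hg, tildeAct_of_notMem θ hh, tildeAct_of_notMem θ hgh,
      LinearMap.comp_apply, LinearMap.comp_apply, ← tensorSq_mul]
    congr 2
    ext1; simp
  · have hgh : ((g * h : tildeG G) : Orth d) ∉ G := fun H => hg ((G.mul_mem_cancel_right hh).1 H)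
    rw [tildeAct_of_notMem θ hg, tildeAct_of_mem θ hh, tildeAct_of_notMem θ hgh,
      LinearMap.comp_apply, LinearMap.comp_apply, swap_tensorSq, ← tensorSq_mul]
    congr 2
    ext1; simp
  · have hg' := neg_mem_of_mem_tildeG g.2 hg
    have hh' := neg_mem_of_mem_tildeG h.2 hh
    have hgh : ((g * h : tildeG G) : Orth d) ∈ G := by simpa using G.mul_mem hg' hh'
    rw [tildeAct_of_notMem θ hg, tildeAct_of_notMem θ hh, tildeAct_of_mem θ hgh,
      LinearMap.comp_apply, LinearMap.comp_apply, swap_tensorSq, swap_swap, ← tensorSq_mul]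
    congr 2
    ext1; simp

theorem tildeAct_mem (g : tildeG G) (t : U ⊗[ℝ] U) (ht : t ∈ tildeU U G) :
    tildeAct θ g t ∈ tildeU U G := by
  by_cases hI : (-1 : Orth d) ∈ G
  · have hU : tildeU U G = symTensors U := by simp [tildeU, hI]
    rw [hU] at ht ⊢
    have ht' : swap U t = t := ht
    change swap U (tildeAct θ g t) = tildeAct θ g t
    by_cases hg : (g : Orth d) ∈ G
    · rw [tildeAct_of_mem θ hg, swap_tensorSq, ht']
    · rw [tildeAct_of_notMem θ hg, LinearMap.comp_apply, ht', swap_tensorSq, ht']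
  · simp [tildeU, hI]

/-- The representation `θ^Ũ` of `G̃` in `Ũ`. -/
def tildeRep : Representation ℝ (tildeG G) (tildeU U G) where
  toFun g := (tildeAct θ g).restrict (tildeAct_mem θ g)
  map_one' := by
    ext t
    simp [tildeAct_one]
  map_mul' g h := by
    ext t
    simp [tildeAct_mul]

end Group

/-! ### Random fields -/

section Fields

variable {d : ℕ} {U : Type*} [NormedAddCommGroup U] [InnerProductSpace ℝ U]

/-- `T` is a centred second-order mean-square continuous `cU`-valued random field on `ℝ^d`. -/
structure IsCentredField {Ω : Type u} [MeasurableSpace Ω] (P : Measure Ω)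
    (T : Space d → Ω → Complexification U) : Prop where
  measurable : ∀ x, Measurable (T x)
  secondOrder : ∀ x, MemLp (T x) 2 P
  centred : ∀ x, ∫ ω, T x ω ∂P = 0
  meanSquareContinuous : ∀ x, Tendsto (fun y => ∫ ω, ‖T x ω - T y ω‖ ^ 2 ∂P) (𝓝 x) (𝓝 0)

/-- The two-point correlation tensor `E[j T(x) ⊗ T(y)]` of a centred `cU`-valued random field.
Here `j` is the conjugation of `cU`, and `j v ⊗ w` is the operator `u ↦ H(v, u) w` on `cU`. -/
def twoPoint {Ω : Type u} [MeasurableSpace Ω] (P : Measure Ω)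
    (T : Space d → Ω → Complexification U) (x y : Space d) :
    Complexification U →L[ℂ] Complexification U :=
  ∫ ω, InnerProductSpace.rankOne ℂ (T y ω) (T x ω) ∂P

/-- Wide-sense homogeneity: the one- and two-point correlation tensors are shift-invariant. -/
def IsHomogeneous {Ω : Type u} [MeasurableSpace Ω] (P : Measure Ω)
    (T : Space d → Ω → Complexification U) : Prop :=
  (∀ x z, ∫ ω, T (x + z) ω ∂P = ∫ ω, T x ω ∂P) ∧
    ∀ x y z, twoPoint P T (x + z) (y + z) = twoPoint P T x y

/-- Wide-sense isotropy: `⟨T(gx)⟩ = θ(g) ⟨T(x)⟩` and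
`⟨T(gx), T(gy)⟩ = (θ ⊗ θ)(g) ⟨T(x), T(y)⟩` for `g ∈ G`. On operators, `(θ ⊗ θ)(g)` is
`C ↦ θ(g) C θ(g)⁻¹`. -/
def IsIsotropic [FiniteDimensional ℝ U] {G : Subgroup (Orth d)} (θ : G →* (U ≃ₗᵢ[ℝ] U))
    {Ω : Type u} [MeasurableSpace Ω] (P : Measure Ω)
    (T : Space d → Ω → Complexification U) : Prop :=
  (∀ (g : G) (x : Space d), ∫ ω, T (rot g.1 x) ω ∂P =
      complexifyOp (θ g).toLinearEquiv.toLinearMap (∫ ω, T x ω ∂P)) ∧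
    ∀ (g : G) (x y : Space d), twoPoint P T (rot g.1 x) (rot g.1 y) =
      complexifyOp (θ g).toLinearEquiv.toLinearMap ∘L twoPoint P T x y ∘L
        complexifyOp (θ g⁻¹).toLinearEquiv.toLinearMap

/-- The `U`-valued random field `S`, regarded as a `cU`-valued one. -/
def asComplex {Ω : Type u} (S : Space d → Ω → U) : Space d → Ω → Complexification U :=
  fun x ω => ofReal (S x ω)

/-- The `cU`-valued random field `T` is, as far as its two-point correlation tensor is concerned,
`U`-valued: some `U`-valued field has the same two-point correlation tensor. -/
def IsUValued {Ω : Type u} [MeasurableSpace Ω] (P : Measure Ω)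
    (T : Space d → Ω → Complexification U) : Prop :=
  ∃ (Ω' : Type u) (_ : MeasurableSpace Ω') (P' : Measure Ω') (_ : IsProbabilityMeasure P')
    (S : Space d → Ω' → U), IsCentredField P' (asComplex S) ∧
      ∀ x y, twoPoint P' (asComplex S) x y = twoPoint P T x y

/-- `F` is the spectral measure of `T`: `⟨T(x), T(y)⟩ = ∫ exp(i (k, y - x)) dF(k)`. -/
def IsSpectralMeasure {Ω : Type u} [MeasurableSpace Ω] (P : Measure Ω)
    (T : Space d → Ω → Complexification U)
    (F : VectorMeasure (Space d) (Complexification U →L[ℂ] Complexification U)) : Prop :=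
  ∀ x y, twoPoint P T x y =
    ∫ᵛ k, Complex.exp (Complex.I * ((inner ℝ k (y - x) : ℝ) : ℂ))
      ∂[ContinuousLinearMap.lsmul ℝ ℂ; F]

/-- `F` takes values in the intersection of `Ũ` with the cone of Hermitian nonnegative-definite
operators on `cU`. -/
def TakesTildeValues [FiniteDimensional ℝ U] (G : Subgroup (Orth d))
    (F : VectorMeasure (Space d) (Complexification U →L[ℂ] Complexification U)) : Prop :=
  ∀ A, MeasurableSet A → (∃ t : tildeU U G, F A = hermOp U t) ∧ (F A).IsPositive

/-- `F(g̃ A) = θ^Ũ(g̃) F(A)` for all `g̃ ∈ G̃` and all Borel sets `A`. -/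
def IsTildeEquivariant [FiniteDimensional ℝ U] {G : Subgroup (Orth d)} (θ : G →* (U ≃ₗᵢ[ℝ] U))
    (F : VectorMeasure (Space d) (Complexification U →L[ℂ] Complexification U)) : Prop :=
  ∀ (g : tildeG G) (A : Set (Space d)), MeasurableSet A → ∀ t : tildeU U G, F A = hermOp U t →
    F (rot g.1 '' A) = hermOp U (tildeRep θ g t)

end Fields

end

end RandomField

open RandomField

/-!
The condition on the spectral measure is first freed from tensors. Under the identification
`hermOp`, transposition of tensors is the real structure `C ↦ j C j` (`conjOp_hermOp`), and `-I ∈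
G̃` acts on `Ũ` as the transposition, whether or not it belongs to `G`. Since every nonnegative
operator comes from a tensor (`exists_eq_hermOp`), the condition says that `F` is nonnegative,
that `F(-A) = j F(A) j`, and that `F(gA) = θ(g) F(A) θ(g)⁻¹` for `g ∈ G` (`IsAdmissible`).

The Fourier transform `x ↦ ∫ exp (i (k, x)) dF(k)` of a vector measure with values in a
finite-dimensional space determines the measure (`ext_of_fourier`), since trigonometric
polynomials are dense in `L²` of every finite measure. The last two conditions therefore translate
into: the Fourier transform is fixed by the real structure, and it is equivariant under `G`. If
`F` is the spectral measure of a field `T`, the two-point correlation tensor `⟨T(x), T(y)⟩` is the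
Fourier transform at `y - x`, so homogeneity is automatic, reality of the Fourier transform holds
if the tensor is that of a `U`-valued field, and equivariance is isotropy. Nonnegativity of `F`
holds for every field: `∫ |p|² d(v, F v)` is the expectation of a square for each trigonometric
polynomial `p`, and the indicator of a set is a limit of trigonometric polynomials in mean square
(`nonneg_of_fourier_posDef`, `isPositive_of_isSpectralMeasure`).

Conversely, let `F` be nonnegative with real Fourier transform. It has a nonnegative density `f`
relative to a probability measure `μ` on the wavenumber domain (`exists_nonneg_density`). Choose a
wavevector `k` with law `μ`, and independently and uniformly a vector `w_j` of an orthonormal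
basis, enlarged by the zero vector so as to be nonempty, and a phase `i^s`. Up to a constant
factor, the field `x ↦ re (i^s exp (i (k, x)) √f(k) w_j)` has spectral measure `F`: averaging over
the phase leaves the rank one operator of the complex wave and its conjugate
(`sum_rankOne_phase`), averaging over the basis gives `exp (i (k, y - x)) f(k)` and its conjugate,
and the integrals over `k` of these two coincide because the Fourier transform is real
(`exists_waveField`).
-/

namespace RandomFieldSpectrum

noncomputable section

/-! ### Vector measures with values in a finite-dimensional space -/

section FiniteDimensional

variable {X : Type*} [MeasurableSpace X]
  {V : Type*} [NormedAddCommGroup V] [NormedSpace ℝ V]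

/-- A vector measure with values in a finite-dimensional space has finite total variation, since
each of its coordinates has. -/
theorem isFiniteMeasure_variation [FiniteDimensional ℝ V] (F : VectorMeasure X V) :
    IsFiniteMeasure F.variation := by
  let b := Module.finBasis ℝ V
  let s : Fin (Module.finrank ℝ V) → SignedMeasure X := fun i =>
    F.mapRange (LinearMap.toContinuousLinearMap (b.coord i) : V →+ ℝ)
      (LinearMap.toContinuousLinearMap (b.coord i)).continuous
  let m : Measure X := ∑ i, ‖b i‖₊ • (s i).variation
  have hm : ∀ i, IsFiniteMeasure (s i).variation := fun i => by
    rw [← SignedMeasure.totalVariation_eq_variation, SignedMeasure.totalVariation]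
    infer_instance
  have : IsFiniteMeasure m := by
    refine ⟨?_⟩
    simp only [m, Measure.coe_finsetSum, Finset.sum_apply]
    exact ENNReal.sum_lt_top.2 fun i _ => measure_lt_top _ _
  refine isFiniteMeasure_of_le m (VectorMeasure.variation_le_of_forall_enorm_le fun E _ => ?_)
  calc ‖F E‖ₑ = ‖∑ i, (s i E) • b i‖ₑ := by
        congr 1; exact (b.sum_repr (F E)).symm
    _ ≤ ∑ i, ‖(s i E) • b i‖ₑ := enorm_sum_le _ _
    _ ≤ ∑ i, ‖b i‖₊ • (s i).variation E := by
        refine Finset.sum_le_sum fun i _ => ?_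
        rw [enorm_smul, mul_comm]
        exact mul_le_mul_right (VectorMeasure.enorm_measure_le_variation _ _) _
    _ = m E := by simp [m, Measure.coe_finsetSum, Finset.sum_apply]

/-- The Radon–Nikodym theorem for vector measures with values in a finite-dimensional space. -/
theorem exists_eq_withDensity [FiniteDimensional ℝ V] (F : VectorMeasure X V)
    (μ : Measure X) [SigmaFinite μ] (hμ : F.variation ≪ μ) :
    ∃ f : X → V, StronglyMeasurable f ∧ Integrable f μ ∧ F = μ.withDensityᵥ f := by
  let b := Module.finBasis ℝ V
  let s : Fin (Module.finrank ℝ V) → SignedMeasure X := fun i =>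
    F.mapRange (LinearMap.toContinuousLinearMap (b.coord i) : V →+ ℝ)
      (LinearMap.toContinuousLinearMap (b.coord i)).continuous
  have hs : ∀ i, μ.withDensityᵥ ((s i).rnDeriv μ) = s i := fun i => by
    refine SignedMeasure.withDensityᵥ_rnDeriv_eq _ _ ?_
    refine VectorMeasure.AbsolutelyContinuous.mk fun A hA h0 => ?_
    rw [Measure.toENNRealVectorMeasure_apply_measurable hA] at h0
    have : F A = 0 := by
      have := VectorMeasure.enorm_measure_le_variation F A
      rw [hμ h0] at this
      simpa using this
    change b.coord i (F A) = 0
    rw [this, map_zero]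
  have hi : ∀ i, Integrable ((s i).rnDeriv μ) μ := fun i => SignedMeasure.integrable_rnDeriv _ _
  have hint : Integrable (fun x => ∑ i, (s i).rnDeriv μ x • b i) μ :=
    integrable_finsetSum _ fun i _ => (hi i).smul_const _
  refine ⟨fun x => ∑ i, (s i).rnDeriv μ x • b i, ?_, hint, ?_⟩
  · refine Finset.stronglyMeasurable_fun_sum _ fun i _ => ?_
    exact (SignedMeasure.measurable_rnDeriv _ _).stronglyMeasurable.smul_const _
  · ext A hA
    rw [withDensityᵥ_apply hint hA, integral_finsetSum _ fun i _ =>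
      ((hi i).smul_const _).integrableOn]
    simp_rw [integral_smul_const]
    rw [← b.sum_repr (F A)]
    refine Finset.sum_congr rfl fun i _ => ?_
    rw [← withDensityᵥ_apply (hi i) hA, hs i]
    rfl

variable {E W : Type*} [NormedAddCommGroup E] [NormedSpace ℝ E]
  [NormedAddCommGroup W] [NormedSpace ℝ W]

theorem integrable_norm_smul_of_integrable_variation [CompleteSpace V] {μ : Measure X} {f : X → V}
    (hf : Integrable f μ) {g : X → E} (hg : Integrable g (μ.withDensityᵥ f).variation) :
    Integrable (fun x => ‖f x‖ • g x) μ := by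
  rw [Measure.variation_withDensityᵥ hf] at hg
  have h := (integrable_withDensity_iff_integrable_smul₀' (μ := μ) (f := fun x => ‖f x‖ₑ)
    hf.1.enorm (by simp)).1 hg
  simpa using h

theorem integral_norm_smul_eq_integral_variation [CompleteSpace V] {μ : Measure X} {f : X → V}
    (hf : Integrable f μ) (g : X → E) :
    ∫ x, g x ∂(μ.withDensityᵥ f).variation = ∫ x, ‖f x‖ • g x ∂μ := by
  rw [Measure.variation_withDensityᵥ hf,
    integral_withDensity_eq_integral_toReal_smul₀ hf.1.enorm (by simp)]
  simp

/-- The integral with respect to a vector measure with density is the integral against the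
density. -/
theorem integral_withDensity [CompleteSpace V] [CompleteSpace W] {μ : Measure X} {f : X → V}
    (hf : Integrable f μ) (B : E →L[ℝ] V →L[ℝ] W) {g : X → E}
    (hg : Integrable g (μ.withDensityᵥ f).variation) :
    ∫ᵛ x, g x ∂[B; μ.withDensityᵥ f] = ∫ x, B (g x) (f x) ∂μ := by
  -- The variation has density `‖f‖`, so functions equal almost everywhere for the variation may
  -- differ only where `f` vanishes.
  have hae : ∀ {g g' : X → E}, g =ᵐ[(μ.withDensityᵥ f).variation] g' →
      (fun x => B (g x) (f x)) =ᵐ[μ] fun x => B (g' x) (f x) := fun {g g'} h => by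
    rw [Measure.variation_withDensityᵥ hf] at h
    filter_upwards [(ae_withDensity_iff' hf.1.enorm).1 h] with x hx
    by_cases h0 : f x = 0
    · simp [h0]
    · simp [hx (by simpa using h0)]
  have hint : ∀ {g : X → E}, Integrable g (μ.withDensityᵥ f).variation →
      Integrable (fun x => B (g x) (f x)) μ := fun {g} hg => by
    have hm : AEStronglyMeasurable (fun x => B (hg.1.mk g x) (f x)) μ :=
      B.aestronglyMeasurable_comp₂ hg.1.stronglyMeasurable_mk.aestronglyMeasurable hf.1
    have h1 := integrable_norm_smul_of_integrable_variation hf hg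
    refine (h1.norm.const_mul ‖B‖).mono' (hm.congr (hae hg.1.ae_eq_mk).symm)
      (ae_of_all _ fun x => ?_)
    refine (B.le_opNorm₂ _ _).trans (le_of_eq ?_)
    rw [norm_smul, norm_norm]; ring
  refine Integrable.induction
    (P := fun g => ∫ᵛ x, g x ∂[B; μ.withDensityᵥ f] = ∫ x, B (g x) (f x) ∂μ) ?_ ?_ ?_ ?_ hg
  · intro c s hs hμs
    have : IsFiniteMeasure ((μ.withDensityᵥ f).variation.restrict s) := ⟨by simpa using hμs⟩
    rw [VectorMeasure.integral_indicator_const c hs, withDensityᵥ_apply hf hs,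
      ← ContinuousLinearMap.integral_comp_comm _ hf.integrableOn, ← integral_indicator hs]
    refine integral_congr_ae (ae_of_all _ fun x => ?_)
    by_cases hx : x ∈ s <;> simp [hx]
  · intro g g' _ hg hg' h h'
    rw [VectorMeasure.integral_add hg hg', h, h', ← integral_add (hint hg) (hint hg')]
    simp
  · refine isClosed_eq VectorMeasure.continuous_integral ?_
    refine (LipschitzWith.of_dist_le_mul (K := ‖B‖₊) fun g g' => ?_).continuous
    have hd := (L1.integrable_coeFn g).sub (L1.integrable_coeFn g')
    rw [dist_eq_norm, ← integral_sub (hint (L1.integrable_coeFn g)) (hint (L1.integrable_coeFn g')),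
      L1.dist_eq_integral_dist, integral_norm_smul_eq_integral_variation hf, ← integral_const_mul]
    refine norm_integral_le_of_norm_le ?_ (ae_of_all _ fun x => ?_)
    · simpa [dist_eq_norm] using
        (integrable_norm_smul_of_integrable_variation hf hd.norm).const_mul ‖B‖
    · rw [← sub_apply, ← map_sub]
      refine (B.le_opNorm₂ _ _).trans (le_of_eq ?_)
      rw [coe_nnnorm, dist_eq_norm, smul_eq_mul]; ring
  · intro g g' h _ h1
    rw [← VectorMeasure.integral_congr_ae h, h1]
    exact integral_congr_ae (hae h)

/-- Transport of the integral along linear maps of the scalars, of the vector measure and of the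
values, which are compatible with the pairings. -/
theorem integral_mapRange [FiniteDimensional ℝ V] [CompleteSpace W]
    {E' V' W' : Type*} [NormedAddCommGroup E'] [NormedSpace ℝ E']
    [NormedAddCommGroup V'] [NormedSpace ℝ V'] [CompleteSpace V']
    [NormedAddCommGroup W'] [NormedSpace ℝ W'] [CompleteSpace W']
    (F : VectorMeasure X V) (B : E →L[ℝ] V →L[ℝ] W) (B' : E' →L[ℝ] V' →L[ℝ] W')
    (φ : E →L[ℝ] E') (L : V →L[ℝ] V') (K : W →L[ℝ] W')
    (h : ∀ e v, B' (φ e) (L v) = K (B e v)) {g : X → E} (hg : Integrable g F.variation) :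
    ∫ᵛ x, φ (g x) ∂[B'; F.mapRange (L : V →+ V') L.continuous] = K (∫ᵛ x, g x ∂[B; F]) := by
  have hfin := isFiniteMeasure_variation F
  have hcomplete : CompleteSpace V := FiniteDimensional.complete ℝ V
  obtain ⟨f, -, hf, hF⟩ := exists_eq_withDensity F F.variation Measure.AbsolutelyContinuous.rfl
  have hLF : F.mapRange (L : V →+ V') L.continuous = F.variation.withDensityᵥ fun x => L (f x) := by
    ext A hA
    rw [withDensityᵥ_apply (L.integrable_comp hf) hA, L.integral_comp_comm hf.integrableOn,
      ← withDensityᵥ_apply hf hA, ← hF]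
    rfl
  have hvar : (F.mapRange (L : V →+ V') L.continuous).variation ≤ ‖L‖₊ • F.variation := by
    refine VectorMeasure.variation_le_of_forall_enorm_le fun A _ => ?_
    exact (L.le_opENorm _).trans
      (mul_le_mul_right (VectorMeasure.enorm_measure_le_variation _ _) _)
  have hg' : Integrable (fun x => φ (g x)) (F.mapRange (L : V →+ V') L.continuous).variation :=
    (φ.integrable_comp (hg.smul_measure_nnreal (c := ‖L‖₊))).mono_measure hvar
  have hint : Integrable (fun x => B (g x) (f x)) F.variation := by
    have h1 : Integrable g (F.variation.withDensityᵥ f).variation := by rwa [← hF]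
    refine ((integrable_norm_smul_of_integrable_variation hf h1).norm.const_mul ‖B‖).mono'
      (B.aestronglyMeasurable_comp₂ hg.1 hf.1) (ae_of_all _ fun x => ?_)
    refine (B.le_opNorm₂ _ _).trans (le_of_eq ?_)
    rw [norm_smul, norm_norm]; ring
  rw [hLF] at hg' ⊢
  rw [integral_withDensity (L.integrable_comp hf) B' hg']
  have h2 : ∫ᵛ x, g x ∂[B; F] = ∫ x, B (g x) (f x) ∂F.variation := by
    rw [← integral_withDensity hf B (by rwa [← hF]), ← hF]
  rw [h2, ← K.integral_comp_comm hint]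
  simp only [h]

end FiniteDimensional

/-! ### Fourier transforms of vector measures -/

section Fourier

variable {H : Type*} [NormedAddCommGroup H] [InnerProductSpace ℝ H]

/-- The character `k ↦ exp (i (k, x))`. -/
def character (x k : H) : ℂ := Complex.exp (Complex.I * ((inner ℝ k x : ℝ) : ℂ))

theorem norm_character (x k : H) : ‖character x k‖ = 1 := by
  rw [character, mul_comm, Complex.norm_exp_ofReal_mul_I]

theorem star_character (x k : H) : (starRingEnd ℂ) (character x k) = character (-x) k := by
  simp [character, ← Complex.exp_conj]

theorem character_mul (x y k : H) : character x k * character y k = character (x + y) k := by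
  simp [character, ← Complex.exp_add, inner_add_right, mul_add]

@[fun_prop]
theorem continuous_character (x : H) : Continuous (character x) := by
  unfold character; fun_prop

theorem continuous_character_left (k : H) : Continuous fun x => character x k := by
  unfold character; fun_prop

/-- The trigonometric polynomial `∑ x, c x • exp (i (·, x))`. -/
def trigPoly (c : H →₀ ℂ) (k : H) : ℂ := c.sum fun x a => a * character x k

@[fun_prop]
theorem continuous_trigPoly (c : H →₀ ℂ) : Continuous (trigPoly c) := by
  unfold trigPoly Finsupp.sum; fun_prop

theorem norm_trigPoly_le (c : H →₀ ℂ) (k : H) : ‖trigPoly c k‖ ≤ c.sum fun _ a => ‖a‖ := by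
  refine (norm_sum_le _ _).trans (Finset.sum_le_sum fun x _ => ?_)
  rw [norm_mul, norm_character, mul_one]

variable [MeasurableSpace H] [BorelSpace H]

theorem memLp_character (μ : Measure H) [IsFiniteMeasure μ] (x : H) (p : ENNReal) :
    MemLp (character x) p μ :=
  MemLp.of_bound (continuous_character x).aestronglyMeasurable 1
    (ae_of_all _ fun k => (norm_character x k).le)

theorem integrable_character (μ : Measure H) [IsFiniteMeasure μ] (x : H) :
    Integrable (character x) μ := memLp_one_iff_integrable.1 (memLp_character μ x 1)

theorem integrable_trigPoly (μ : Measure H) [IsFiniteMeasure μ] (c : H →₀ ℂ) :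
    Integrable (trigPoly c) μ :=
  Integrable.of_bound (continuous_trigPoly c).aestronglyMeasurable _
    (ae_of_all _ (norm_trigPoly_le c))

variable {V : Type*} [NormedAddCommGroup V] [NormedSpace ℝ V] [NormedSpace ℂ V]
  [IsScalarTower ℝ ℂ V]

/-- The Fourier transform `x ↦ ∫ exp (i (k, x)) dF(k)` of a vector measure. -/
def fourier (F : VectorMeasure H V) (x : H) : V :=
  ∫ᵛ k, character x k ∂[ContinuousLinearMap.lsmul ℝ ℂ; F]

theorem fourier_map (F : VectorMeasure H V) (e : H ≃ₗᵢ[ℝ] H) (x : H) :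
    fourier (F.map e) x = fourier F (e.symm x) := by
  rw [fourier, e.toHomeomorph.measurableEmbedding.integral_map_vectorMeasure (φ := e), fourier]
  congr 1
  funext k
  rw [character, character, ← e.inner_map_map k (e.symm x), e.apply_symm_apply]

variable [FiniteDimensional ℝ V]

theorem integral_trigPoly (F : VectorMeasure H V) (c : H →₀ ℂ) :
    ∫ᵛ k, trigPoly c k ∂[ContinuousLinearMap.lsmul ℝ ℂ; F] = c.sum fun x a => a • fourier F x := by
  have hfin := isFiniteMeasure_variation F
  have hcomplete : CompleteSpace V := FiniteDimensional.complete ℝ V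
  unfold trigPoly Finsupp.sum
  rw [VectorMeasure.integral_finsetSum _ fun x _ =>
    ((integrable_character F.variation x).const_mul (c x) : F.Integrable _)]
  refine Finset.sum_congr rfl fun x _ => ?_
  have := integral_mapRange F (ContinuousLinearMap.lsmul ℝ ℂ) (ContinuousLinearMap.lsmul ℝ ℂ)
    (ContinuousLinearMap.mul ℝ ℂ (c x)) (ContinuousLinearMap.id ℝ V)
    (ContinuousLinearMap.lsmul ℝ ℂ (c x)) (fun e v => by simp [mul_smul])
    (integrable_character F.variation x)
  exact this

theorem fourier_mapRange {V' : Type*} [NormedAddCommGroup V'] [NormedSpace ℝ V'] [NormedSpace ℂ V']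
    [IsScalarTower ℝ ℂ V'] [CompleteSpace V'] (F : VectorMeasure H V) (L : V →L[ℝ] V')
    (hL : ∀ (a : ℂ) v, L (a • v) = a • L v) (x : H) :
    fourier (F.mapRange (L : V →+ V') L.continuous) x = L (fourier F x) := by
  have hfin := isFiniteMeasure_variation F
  have hcomplete : CompleteSpace V := FiniteDimensional.complete ℝ V
  exact integral_mapRange F (ContinuousLinearMap.lsmul ℝ ℂ) (ContinuousLinearMap.lsmul ℝ ℂ)
    (ContinuousLinearMap.id ℝ ℂ) L L (fun e v => (hL e v).symm) (integrable_character F.variation x)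

/-- The Fourier transform of the image of a vector measure under a conjugate-linear map. -/
theorem fourier_mapRange_conj {V' : Type*} [NormedAddCommGroup V'] [NormedSpace ℝ V']
    [NormedSpace ℂ V'] [IsScalarTower ℝ ℂ V'] [CompleteSpace V'] (F : VectorMeasure H V)
    (L : V →L[ℝ] V') (hL : ∀ (a : ℂ) v, L (a • v) = (starRingEnd ℂ) a • L v) (x : H) :
    fourier (F.mapRange (L : V →+ V') L.continuous) x = L (fourier F (-x)) := by
  have hfin := isFiniteMeasure_variation F
  have hcomplete : CompleteSpace V := FiniteDimensional.complete ℝ V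
  have := integral_mapRange F (ContinuousLinearMap.lsmul ℝ ℂ) (ContinuousLinearMap.lsmul ℝ ℂ)
    (Complex.conjLIE.toContinuousLinearEquiv.toContinuousLinearMap : ℂ →L[ℝ] ℂ) L L
    (fun e v => (hL e v).symm) (integrable_character F.variation (-x))
  rw [fourier, fourier, ← this]
  congr 1
  funext k
  simp [star_character]

variable [FiniteDimensional ℝ H]

/-- A real integrable function with vanishing Fourier transform vanishes almost everywhere: the
finite measures with densities its positive and negative parts have the same characteristic
function. -/
theorem ae_eq_zero_of_integral_character_mul_ofReal {μ : Measure H} [IsFiniteMeasure μ] {u : H → ℝ}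
    (hu : Integrable u μ) (h : ∀ x, ∫ k, character x k * (u k : ℂ) ∂μ = 0) : u =ᵐ[μ] 0 := by
  have h1 := isFiniteMeasure_withDensity_ofReal hu.2
  have h2 := isFiniteMeasure_withDensity_ofReal hu.neg.2
  have hm : ∀ {w : H → ℝ}, Integrable w μ → ∀ x,
      ∫ k, character x k ∂(μ.withDensity fun k => ENNReal.ofReal (w k)) =
        ∫ k, (max (w k) 0 : ℝ) * character x k ∂μ := by
    intro w hw x
    rw [integral_withDensity_eq_integral_toReal_smul₀ hw.1.aemeasurable.ennreal_ofReal (by simp)]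
    simp [ENNReal.toReal_ofReal', Complex.real_smul]
  have hi : ∀ {w : H → ℝ}, Integrable w μ → ∀ x,
      Integrable (fun k => ((max (w k) 0 : ℝ) : ℂ) * character x k) μ := by
    intro w hw x
    exact (hw.pos_part.ofReal (𝕜 := ℂ)).mul_bdd (c := 1)
      (continuous_character x).aestronglyMeasurable (ae_of_all _ fun k => (norm_character x k).le)
  have heq : (μ.withDensity fun k => ENNReal.ofReal (u k)) =
      μ.withDensity fun k => ENNReal.ofReal ((-u) k) := by
    refine Measure.ext_of_charFun (funext fun x => ?_)
    have key := hm hu x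
    have key' := hm hu.neg x
    simp only [charFun_apply, character, mul_comm Complex.I] at key key' ⊢
    rw [key, key', ← sub_eq_zero]
    have := integral_sub (hi hu x) (hi hu.neg x)
    simp only [character, mul_comm Complex.I] at this
    rw [← this, ← h x]
    refine integral_congr_ae (ae_of_all _ fun k => ?_)
    simp only [character, Pi.neg_apply, mul_comm Complex.I]
    rw [← sub_mul, ← Complex.ofReal_sub, max_zero_sub_max_neg_zero_eq_self, mul_comm]
  have hae := (withDensity_eq_iff (hu.1.aemeasurable.ennreal_ofReal)
    (hu.neg.1.aemeasurable.ennreal_ofReal) (by simpa using hu.lintegral_lt_top.ne)).1 heq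
  filter_upwards [hae] with k hk
  rcases le_total (u k) 0 with h0 | h0
  · rw [ENNReal.ofReal_of_nonpos h0, eq_comm, ENNReal.ofReal_eq_zero] at hk
    simp only [Pi.neg_apply, Left.neg_nonpos_iff] at hk
    exact le_antisymm h0 hk
  · have h3 : ENNReal.ofReal ((-u) k) = 0 := ENNReal.ofReal_of_nonpos (by simpa using h0)
    rw [h3, ENNReal.ofReal_eq_zero] at hk
    exact le_antisymm hk h0

/-- Injectivity of the Fourier transform on `L¹(μ)`. -/
theorem ae_eq_zero_of_integral_character_mul {μ : Measure H} [IsFiniteMeasure μ] {f : H → ℂ}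
    (hf : Integrable f μ) (h : ∀ x, ∫ k, character x k * f k ∂μ = 0) : f =ᵐ[μ] 0 := by
  have hi : ∀ x, Integrable (fun k => character x k * f k) μ := fun x =>
    hf.bdd_mul (c := 1) (continuous_character x).aestronglyMeasurable
      (ae_of_all _ fun k => (norm_character x k).le)
  have hi' : ∀ x, Integrable (fun k => character x k * (starRingEnd ℂ) (f k)) μ := fun x =>
    (Complex.conjLIE.toContinuousLinearEquiv.toContinuousLinearMap.integrable_comp hf).bdd_mul
      (c := 1) (continuous_character x).aestronglyMeasurable
      (ae_of_all _ fun k => (norm_character x k).le)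
  have h' : ∀ x, ∫ k, character x k * (starRingEnd ℂ) (f k) ∂μ = 0 := fun x => by
    have := congrArg (starRingEnd ℂ) (h (-x))
    rw [← integral_conj, map_zero] at this
    simpa [star_character] using this
  have hre : (fun k => (f k).re) =ᵐ[μ] 0 := by
    refine ae_eq_zero_of_integral_character_mul_ofReal hf.re fun x => ?_
    have := integral_add (hi x) (hi' x)
    rw [h, h', add_zero] at this
    rw [← mul_eq_zero_iff_left (two_ne_zero (α := ℂ)), ← integral_const_mul, ← this]
    refine integral_congr_ae (ae_of_all _ fun k => ?_)
    simp only [← mul_add, Complex.add_conj]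
    push_cast; ring
  have him : (fun k => (f k).im) =ᵐ[μ] 0 := by
    refine ae_eq_zero_of_integral_character_mul_ofReal hf.im fun x => ?_
    have := integral_sub (hi x) (hi' x)
    rw [h, h', sub_zero] at this
    rw [← mul_eq_zero_iff_left (mul_ne_zero (two_ne_zero (α := ℂ)) Complex.I_ne_zero),
      ← integral_const_mul, ← this]
    refine integral_congr_ae (ae_of_all _ fun k => ?_)
    simp only [← mul_sub, Complex.sub_conj]
    push_cast; ring
  filter_upwards [hre, him] with k h1 h2
  exact Complex.ext h1 h2

/-- The trigonometric polynomials are dense in `L²(μ)`: an element of the orthogonal complement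
has vanishing Fourier transform. -/
theorem closure_span_character (μ : Measure H) [IsFiniteMeasure μ] :
    (Submodule.span ℂ (Set.range fun x : H =>
      (memLp_character μ x 2).toLp (character x))).topologicalClosure = ⊤ := by
  rw [Submodule.topologicalClosure_eq_top_iff, Submodule.eq_bot_iff]
  intro f hf
  rw [Submodule.mem_orthogonal] at hf
  have hi : Integrable f μ := (Lp.memLp f).integrable (by norm_num)
  refine (Lp.eq_zero_iff_ae_eq_zero).2 (ae_eq_zero_of_integral_character_mul hi fun x => ?_)
  have := hf _ (Submodule.subset_span ⟨-x, rfl⟩)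
  rw [L2.inner_def] at this
  rw [← this]
  refine integral_congr_ae ?_
  filter_upwards [(memLp_character μ (-x) 2).coeFn_toLp] with k hk
  rw [hk, RCLike.inner_apply, star_character, neg_neg, mul_comm]

/-- Indicator functions are limits of trigonometric polynomials, in `L²(μ)` and in `L¹(μ)`. -/
theorem exists_trigPoly_tendsto (μ : Measure H) [IsFiniteMeasure μ] {A : Set H}
    (hA : MeasurableSet A) : ∃ c : ℕ → (H →₀ ℂ),
      Tendsto (fun n => eLpNorm (trigPoly (c n) - A.indicator 1) 2 μ) atTop (𝓝 0) ∧
      Tendsto (fun n => eLpNorm (trigPoly (c n) - A.indicator 1) 1 μ) atTop (𝓝 0) := by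
  have hmem : MemLp (A.indicator (1 : H → ℂ)) 2 μ := (memLp_const (1 : ℂ)).indicator hA
  have hcl : hmem.toLp _ ∈ closure (Submodule.span ℂ (Set.range fun x : H =>
      (memLp_character μ x 2).toLp (character x)) : Set (Lp ℂ 2 μ)) := by
    rw [← Submodule.topologicalClosure_coe, closure_span_character]
    trivial
  obtain ⟨p, hp, hlim⟩ := mem_closure_iff_seq_limit.1 hcl
  choose c hc using fun n => Finsupp.mem_span_range_iff_exists_finsupp.1 (hp n)
  have hcoe : ∀ n, p n =ᵐ[μ] trigPoly (c n) := fun n => by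
    rw [← hc n]
    unfold trigPoly Finsupp.sum
    have h1 : ∀ᵐ k ∂μ, ∀ x ∈ (c n).support,
        (c n x • (memLp_character μ x 2).toLp (character x) : Lp ℂ 2 μ) k
          = c n x * character x k := by
      rw [Filter.eventually_all_finset]
      intro x _
      filter_upwards [Lp.coeFn_smul (c n x) ((memLp_character μ x 2).toLp (character x)),
        (memLp_character μ x 2).coeFn_toLp] with k hk hk'
      rw [hk, Pi.smul_apply, hk', smul_eq_mul]
    filter_upwards [h1, Lp.coeFn_finsetSum (c n).support
      fun x => (c n x • (memLp_character μ x 2).toLp (character x) : Lp ℂ 2 μ)] with k hk hk'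
    rw [hk']
    simp only [Finset.sum_apply]
    exact Finset.sum_congr rfl hk
  have h2 : Tendsto (fun n => eLpNorm (trigPoly (c n) - A.indicator 1) 2 μ) atTop (𝓝 0) := by
    rw [Lp.tendsto_Lp_iff_tendsto_eLpNorm'] at hlim
    refine hlim.congr fun n => eLpNorm_congr_ae ?_
    filter_upwards [hcoe n, hmem.coeFn_toLp] with k hk hk'
    rw [Pi.sub_apply, Pi.sub_apply, hk, hk']
  refine ⟨c, h2, ?_⟩
  have h3 := ENNReal.Tendsto.mul_const
    (b := μ Set.univ ^ (1 / (1 : ENNReal).toReal - 1 / (2 : ENNReal).toReal)) h2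
    (Or.inr (ENNReal.rpow_ne_top_of_nonneg (by norm_num) (measure_ne_top _ _)))
  rw [zero_mul] at h3
  refine tendsto_of_tendsto_of_tendsto_of_le_of_le tendsto_const_nhds h3 (fun _ => zero_le)
    fun n => eLpNorm_le_eLpNorm_mul_rpow_measure_univ (by norm_num) ?_
  exact ((continuous_trigPoly _).aestronglyMeasurable.sub hmem.1)

/-- A vector measure is determined by its Fourier transform: the integrals of trigonometric
polynomials are linear combinations of its values, and the measure of a set is a limit of such
integrals. -/
theorem ext_of_fourier {F F' : VectorMeasure H V} (h : ∀ x, fourier F x = fourier F' x) :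
    F = F' := by
  have hfin := isFiniteMeasure_variation F
  have hfin' := isFiniteMeasure_variation F'
  have hcomplete : CompleteSpace V := FiniteDimensional.complete ℝ V
  ext A hA
  obtain ⟨c, -, hc⟩ := exists_trigPoly_tendsto (F.variation + F'.variation) hA
  have key : ∀ G : VectorMeasure H V, G.variation ≤ F.variation + F'.variation →
      IsFiniteMeasure G.variation →
      Tendsto (fun n => (c n).sum fun x a => a • fourier G x) atTop (𝓝 (G A)) := by
    intro G hG _
    have hlim : Tendsto
        (fun n => ∫ᵛ k, trigPoly (c n) k ∂[ContinuousLinearMap.lsmul ℝ ℂ; G]) atTop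
        (𝓝 (∫ᵛ k, A.indicator (1 : H → ℂ) k ∂[ContinuousLinearMap.lsmul ℝ ℂ; G])) :=
      VectorMeasure.tendsto_integral_of_L1' (A.indicator (1 : H → ℂ))
        ((stronglyMeasurable_const (b := (1 : ℂ))).indicator hA).aestronglyMeasurable
      (Eventually.of_forall fun n => integrable_trigPoly _ _)
      (tendsto_of_tendsto_of_tendsto_of_le_of_le tendsto_const_nhds hc (fun _ => zero_le)
        fun n => eLpNorm_mono_measure _ hG)
    have hind : ∫ᵛ k, A.indicator (1 : H → ℂ) k ∂[ContinuousLinearMap.lsmul ℝ ℂ; G] = G A :=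
      (VectorMeasure.integral_indicator_const (1 : ℂ) hA).trans (by simp)
    rw [hind] at hlim
    exact hlim.congr fun n => integral_trigPoly G (c n)
  refine tendsto_nhds_unique (key F (Measure.le_add_right le_rfl) hfin) ?_
  simp only [h]
  exact key F' (Measure.le_add_left le_rfl) hfin'

open scoped ComplexOrder in
/-- The elementary part of Bochner's theorem for complex measures: a complex measure whose
Fourier transform is a positive definite function is nonnegative. The integral of `|p|²` is
nonnegative for trigonometric polynomials `p`, and the indicator of a set is a limit of such `p`
in mean square. -/
theorem nonneg_of_fourier_posDef (F : VectorMeasure H ℂ)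
    (h : ∀ c : H →₀ ℂ, 0 ≤ c.sum fun x a => c.sum fun y b =>
      (starRingEnd ℂ) a * b * fourier F (y - x)) {A : Set H} (hA : MeasurableSet A) : 0 ≤ F A := by
  have hfin := isFiniteMeasure_variation F
  obtain ⟨c, hc2, hc1⟩ := exists_trigPoly_tendsto F.variation hA
  have hsq : ∀ c : H →₀ ℂ, (fun k => (starRingEnd ℂ) (trigPoly c k) * trigPoly c k) =
      fun k => ∑ x ∈ c.support, ∑ y ∈ c.support,
        (starRingEnd ℂ) (c x) * c y * character (y - x) k := by
    intro c
    funext k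
    simp only [trigPoly, Finsupp.sum, map_sum, map_mul, star_character, Finset.sum_mul_sum]
    refine Finset.sum_congr rfl fun x _ => Finset.sum_congr rfl fun y _ => ?_
    rw [sub_eq_neg_add, ← character_mul]
    ring
  have hval : ∀ c : H →₀ ℂ, 0 ≤ ∫ᵛ k, (starRingEnd ℂ) (trigPoly c k) * trigPoly c k
      ∂[ContinuousLinearMap.lsmul ℝ ℂ; F] := by
    intro c
    have hi : ∀ x y, F.Integrable fun k => (starRingEnd ℂ) (c x) * c y * character (y - x) k :=
      fun x y => (integrable_character F.variation (y - x)).const_mul _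
    rw [hsq, VectorMeasure.integral_finsetSum _ fun x _ =>
      VectorMeasure.Integrable.fun_finsetSum _ fun y _ => hi x y]
    refine (h c).trans_eq (Finset.sum_congr rfl fun x _ => ?_)
    rw [VectorMeasure.integral_finsetSum _ fun y _ => hi x y]
    refine Finset.sum_congr rfl fun y _ => ?_
    have := integral_trigPoly F (Finsupp.single (y - x) ((starRingEnd ℂ) (c x) * c y))
    simp only [trigPoly, Finsupp.sum_single_index, zero_mul, smul_eq_mul] at this
    exact this.symm
  have hlim : Tendsto (fun n => ∫ᵛ k, (starRingEnd ℂ) (trigPoly (c n) k) * trigPoly (c n) k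
        ∂[ContinuousLinearMap.lsmul ℝ ℂ; F]) atTop
      (𝓝 (∫ᵛ k, A.indicator (1 : H → ℂ) k ∂[ContinuousLinearMap.lsmul ℝ ℂ; F])) := by
    refine VectorMeasure.tendsto_integral_of_L1 (A.indicator (1 : H → ℂ))
      ((stronglyMeasurable_const (b := (1 : ℂ))).indicator hA).aestronglyMeasurable
      (Eventually.of_forall fun n => ?_) ?_
    · rw [hsq]
      exact VectorMeasure.Integrable.fun_finsetSum _ fun x _ =>
        VectorMeasure.Integrable.fun_finsetSum _ fun y _ =>
          (integrable_character F.variation (y - x)).const_mul _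
    · have hb : Tendsto (fun n => eLpNorm (trigPoly (c n) - A.indicator 1) 2 F.variation ^ (2 : ℝ) +
          2 * eLpNorm (trigPoly (c n) - A.indicator 1) 1 F.variation) atTop (𝓝 0) := by
        have h1 := (ENNReal.continuous_rpow_const (y := 2)).tendsto 0 |>.comp hc2
        have h2 := ENNReal.Tendsto.const_mul (a := 2) hc1 (Or.inr (by simp))
        simpa using h1.add h2
      refine tendsto_of_tendsto_of_tendsto_of_le_of_le tendsto_const_nhds hb (fun _ => zero_le)
        fun n => ?_
      have hm : Measurable fun k => ‖(trigPoly (c n) - A.indicator (1 : H → ℂ)) k‖ₑ :=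
        ((continuous_trigPoly _).measurable.sub (measurable_const.indicator hA)).enorm
      rw [eLpNorm_one_eq_lintegral_enorm,
        eLpNorm_eq_lintegral_rpow_enorm_toReal (by norm_num) (by norm_num), ← ENNReal.rpow_mul,
        ENNReal.toReal_ofNat, one_div, inv_mul_cancel₀ two_ne_zero, ENNReal.rpow_one,
        ← lintegral_const_mul _ hm, ← lintegral_add_left (by simpa using hm.pow_const (2 : ℝ))]
      refine lintegral_mono fun k => ?_
      set p := trigPoly (c n) k
      set q := A.indicator (1 : H → ℂ) k with hq
      have hq' : (starRingEnd ℂ) q * q = q ∧ ‖q‖ ≤ 1 := by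
        by_cases hk : k ∈ A <;> simp [hq, hk]
      -- `|p|² - |q|² = |p - q|² + conj q (p - q) + conj (p - q) q`
      have hpq : (starRingEnd ℂ) p * p - q =
          (starRingEnd ℂ) (p - q) * (p - q) + ((starRingEnd ℂ) q * (p - q)
            + (starRingEnd ℂ) (p - q) * q) := by
        conv_lhs => rw [← hq'.1]
        rw [map_sub]; ring
      have hn : ‖(starRingEnd ℂ) p * p - q‖ ≤ ‖p - q‖ ^ 2 + 2 * ‖p - q‖ := by
        rw [hpq]
        refine (norm_add_le _ _).trans (add_le_add (le_of_eq ?_) ((norm_add_le _ _).trans ?_))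
        · rw [norm_mul, RCLike.norm_conj, sq]
        · rw [norm_mul, norm_mul, RCLike.norm_conj, RCLike.norm_conj, two_mul]
          exact add_le_add (mul_le_of_le_one_left (norm_nonneg _) hq'.2)
            (mul_le_of_le_one_right (norm_nonneg _) hq'.2)
      rw [← ofReal_norm, Pi.sub_apply, ← hq, ← ofReal_norm (p - q), ENNReal.rpow_two]
      refine (ENNReal.ofReal_le_ofReal hn).trans_eq ?_
      rw [ENNReal.ofReal_add (by positivity) (by positivity), ENNReal.ofReal_mul zero_le_two,
        ENNReal.ofReal_pow (norm_nonneg _), ENNReal.ofReal_ofNat]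
  have hind : ∫ᵛ k, A.indicator (1 : H → ℂ) k ∂[ContinuousLinearMap.lsmul ℝ ℂ; F] = F A :=
    (VectorMeasure.integral_indicator_const (1 : ℂ) hA).trans (by simp)
  rw [hind] at hlim
  exact ge_of_tendsto' hlim fun n => hval (c n)

end Fourier

/-! ### Conjugation on the complexification -/

section Conjugation

variable {U : Type*} [NormedAddCommGroup U] [InnerProductSpace ℝ U]

theorem inner_eq_hermForm (v w : Complexification U) : inner ℂ v w = hermForm v w := rfl

theorem ctmul_add (z : ℂ) (u u' : U) : ctmul z (u + u') = ctmul z u + ctmul z u' :=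
  TensorProduct.tmul_add z u u'

theorem add_ctmul (z z' : ℂ) (u : U) : ctmul (z + z') u = ctmul z u + ctmul z' u :=
  TensorProduct.add_tmul z z' u

theorem ctmul_smul (z : ℂ) (r : ℝ) (u : U) : ctmul z (r • u) = (r : ℂ) • ctmul z u := by
  rw [smul_ctmul, ctmul, TensorProduct.tmul_smul, TensorProduct.smul_tmul', Complex.real_smul]
  rfl

theorem ctmul_eq_smul (z : ℂ) (u : U) : ctmul z u = z • ofReal u := by
  rw [ofReal, smul_ctmul, mul_one]

theorem ctmul_sub (z : ℂ) (u u' : U) : ctmul z (u - u') = ctmul z u - ctmul z u' :=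
  TensorProduct.tmul_sub z u u'

theorem ctmul_zero (z : ℂ) : ctmul z (0 : U) = 0 := TensorProduct.tmul_zero U z

/-- The additive map `z ⊗ u ↦ z^* ⊗ u` underlying the conjugation. -/
def conjAddHom : Complexification U →+ Complexification U :=
  (LinearMap.rTensor U (Complex.conjAe.toLinearMap) : ℂ ⊗[ℝ] U →ₗ[ℝ] ℂ ⊗[ℝ] U).toAddMonoidHom

theorem conjAddHom_ctmul (z : ℂ) (u : U) : conjAddHom (ctmul z u) = ctmul ((starRingEnd ℂ) z) u :=
  rfl

/-- The conjugation `j` of the complexification `cU`, `z ⊗ u ↦ z^* ⊗ u`. -/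
def conjU : Complexification U →ₗ⋆[ℂ] Complexification U where
  toFun := conjAddHom
  map_add' := map_add _
  map_smul' a v := by
    induction v using Complexification.induction with
    | h0 => simp
    | h2 v w hv hw => rw [smul_add, map_add, map_add, hv, hw, smul_add]
    | h1 z u => rw [smul_ctmul, conjAddHom_ctmul, conjAddHom_ctmul, smul_ctmul, map_mul]

theorem conjU_ctmul (z : ℂ) (u : U) : conjU (ctmul z u) = ctmul ((starRingEnd ℂ) z) u := rfl

theorem conjU_conjU (v : Complexification U) : conjU (conjU v) = v := by
  induction v using Complexification.induction with
  | h0 => simp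
  | h2 v w hv hw => simp [hv, hw]
  | h1 z u => simp [conjU_ctmul]

theorem inner_conjU_conjU (v w : Complexification U) :
    inner ℂ (conjU v) (conjU w) = (starRingEnd ℂ) (inner ℂ v w) := by
  induction v using Complexification.induction with
  | h0 => simp
  | h2 v v' h h' => simp [h, h']
  | h1 z u =>
    induction w using Complexification.induction with
    | h0 => simp
    | h2 v v' h h' => simp [h, h']
    | h1 z' u' => simp [conjU_ctmul, inner_eq_hermForm, hermForm_ctmul]

theorem inner_conjU_left (v w : Complexification U) :
    inner ℂ (conjU v) w = (starRingEnd ℂ) (inner ℂ v (conjU w)) := by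
  rw [← inner_conjU_conjU, conjU_conjU]

theorem norm_conjU (v : Complexification U) : ‖conjU v‖ = ‖v‖ := by
  have h : ‖conjU v‖ ^ 2 = ‖v‖ ^ 2 := by
    rw [@norm_sq_eq_re_inner ℂ, @norm_sq_eq_re_inner ℂ, inner_conjU_conjU]
    simp
  exact (sq_eq_sq₀ (norm_nonneg _) (norm_nonneg _)).1 h

/-- The conjugation as a continuous map. -/
def conjCLM : Complexification U →L⋆[ℂ] Complexification U :=
  conjU.mkContinuous 1 fun v => by rw [norm_conjU, one_mul]

theorem exists_eq_add_I_smul (v : Complexification U) :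
    ∃ a b : U, v = ofReal a + Complex.I • ofReal b := by
  induction v using Complexification.induction with
  | h0 => exact ⟨0, 0, by simp [ofReal, ctmul_zero]⟩
  | h2 v w hv hw =>
    obtain ⟨a, b, rfl⟩ := hv
    obtain ⟨a', b', rfl⟩ := hw
    refine ⟨a + a', b + b', ?_⟩
    simp only [ofReal, ctmul_add, smul_add]
    abel
  | h1 z u =>
    refine ⟨z.re • u, z.im • u, ?_⟩
    rw [ofReal, ofReal, ctmul_smul, ctmul_smul, smul_ctmul, smul_ctmul, smul_ctmul, ← add_ctmul,
      mul_one, mul_one, mul_comm, Complex.re_add_im]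

/-- The additive map `z ⊗ u ↦ (re z) u` underlying the real part. -/
def realPartAddHom : Complexification U →+ U :=
  ((TensorProduct.lid ℝ U).toLinearMap ∘ₗ
    (LinearMap.rTensor U Complex.reLm : ℂ ⊗[ℝ] U →ₗ[ℝ] ℝ ⊗[ℝ] U)).toAddMonoidHom

theorem realPartAddHom_ctmul (z : ℂ) (u : U) : realPartAddHom (ctmul z u) = z.re • u := rfl

/-- The real part `z ⊗ u ↦ (re z) u` of an element of `cU`. -/
def realPart : Complexification U →ₗ[ℝ] U where
  toFun := realPartAddHom
  map_add' := map_add _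
  map_smul' r v := by
    change realPartAddHom ((r : ℂ) • v) = r • realPartAddHom v
    induction v using Complexification.induction with
    | h0 => simp
    | h2 v w hv hw => rw [smul_add, map_add, map_add, hv, hw, smul_add]
    | h1 z u =>
      rw [smul_ctmul, realPartAddHom_ctmul, realPartAddHom_ctmul, Complex.re_ofReal_mul, mul_smul]

theorem realPart_ctmul (z : ℂ) (u : U) : realPart (ctmul z u) = z.re • u := rfl

theorem ofReal_realPart (v : Complexification U) :
    ofReal (realPart v) = (1 / 2 : ℂ) • (v + conjU v) := by
  induction v using Complexification.induction with
  | h0 => simp [ofReal, ctmul_zero]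
  | h2 v w hv hw =>
    rw [map_add, ofReal, ctmul_add, ← ofReal, ← ofReal, hv, hw, map_add, ← smul_add]
    congr 1; abel
  | h1 z u =>
    rw [realPart_ctmul, ofReal, ctmul_smul, conjU_ctmul, ← add_ctmul, smul_ctmul, smul_ctmul,
      Complex.add_conj]
    congr 1
    push_cast; ring

theorem norm_ofReal (u : U) : ‖ofReal u‖ = ‖u‖ := by
  have h : ‖ofReal u‖ ^ 2 = ‖u‖ ^ 2 := by
    rw [norm_sq_eq_hermForm, ofReal, hermForm_ctmul, map_one, one_mul, one_mul,
      Complex.ofReal_re, real_inner_self_eq_norm_sq]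
  exact (sq_eq_sq₀ (norm_nonneg _) (norm_nonneg _)).1 h

theorem norm_realPart_le (v : Complexification U) : ‖realPart v‖ ≤ ‖v‖ := by
  rw [← norm_ofReal, ofReal_realPart, norm_smul]
  have := norm_add_le v (conjU v)
  rw [norm_conjU] at this
  norm_num
  linarith

theorem conjU_ofReal (u : U) : conjU (ofReal u) = ofReal u := by
  rw [ofReal, conjU_ctmul, map_one]

/-- The real structure `C ↦ j C j` on the operators on `cU`. -/
def conjOp (C : Complexification U →L[ℂ] Complexification U) :
    Complexification U →L[ℂ] Complexification U :=
  conjCLM.comp (C.comp conjCLM)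

theorem conjOp_apply (C : Complexification U →L[ℂ] Complexification U) (v : Complexification U) :
    conjOp C v = conjU (C (conjU v)) := rfl

theorem conjOp_add (C D : Complexification U →L[ℂ] Complexification U) :
    conjOp (C + D) = conjOp C + conjOp D := by
  ext v; simp [conjOp_apply]

theorem conjOp_smul (a : ℂ) (C : Complexification U →L[ℂ] Complexification U) :
    conjOp (a • C) = (starRingEnd ℂ) a • conjOp C := by
  ext v; simp [conjOp_apply]

theorem conjOp_rankOne (v w : Complexification U) :
    conjOp (InnerProductSpace.rankOne ℂ v w) =
      InnerProductSpace.rankOne ℂ (conjU v) (conjU w) := by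
  ext u
  rw [conjOp_apply, InnerProductSpace.rankOne_apply, InnerProductSpace.rankOne_apply,
    inner_conjU_left]
  exact map_smulₛₗ conjU _ _

/-- The real structure on the operators on `cU`, as a continuous real-linear map. -/
def conjOpCLM : (Complexification U →L[ℂ] Complexification U) →L[ℝ]
    (Complexification U →L[ℂ] Complexification U) :=
  LinearMap.mkContinuous
    { toFun := conjOp
      map_add' := conjOp_add
      map_smul' := fun r C => by
        have := conjOp_smul (r : ℂ) C
        rw [Complex.conj_ofReal] at this
        exact this } 1 fun C => by
    rw [one_mul]
    refine ContinuousLinearMap.opNorm_le_bound _ (norm_nonneg _) fun v => ?_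
    change ‖conjU (C (conjU v))‖ ≤ _
    rw [norm_conjU, ← norm_conjU v]
    exact C.le_opNorm _

theorem conjOpCLM_apply (C : Complexification U →L[ℂ] Complexification U) :
    conjOpCLM C = conjOp C := rfl

/-! ### Hermitian operators and tensors of rank two -/

theorem ext_ctmul {C D : Complexification U →L[ℂ] Complexification U}
    (h : ∀ z u, C (ctmul z u) = D (ctmul z u)) : C = D := by
  ext v
  induction v using Complexification.induction with
  | h0 => simp
  | h2 v w hv hw => rw [map_add, map_add, hv, hw]
  | h1 z u => exact h z u

theorem tensorOp_map (g : U ≃ₗᵢ[ℝ] U) (t : U ⊗[ℝ] U) (u : U) :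
    tensorOp U (TensorProduct.map g.toLinearEquiv.toLinearMap g.toLinearEquiv.toLinearMap t) u
      = g (tensorOp U t (g.symm u)) := by
  induction t using TensorProduct.induction_on with
  | zero => simp
  | tmul a b =>
    rw [TensorProduct.map_tmul, tensorOp_tmul, tensorOp_tmul, map_smul]
    congr 1
    rw [← g.inner_map_map a, g.apply_symm_apply]
    rfl
  | add x y hx hy => simp only [map_add, LinearMap.add_apply, hx, hy]

variable [FiniteDimensional ℝ U]

theorem hermOp_ctmul (t : U ⊗[ℝ] U) (z : ℂ) (u : U) :
    hermOp U t (ctmul z u) = (1 / 2 : ℂ) • ctmul z (tensorOp U (t + swap U t) u)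
      + (Complex.I / 2) • ctmul z (tensorOp U (t - swap U t) u) := rfl

theorem hermOp_add (s t : U ⊗[ℝ] U) : hermOp U (s + t) = hermOp U s + hermOp U t := by
  simp only [hermOp, map_add, map_sub, smul_add, smul_sub]
  abel

theorem hermOp_smul (r : ℝ) (t : U ⊗[ℝ] U) : hermOp U (r • t) = (r : ℂ) • hermOp U t := by
  simp only [hermOp, map_smul, ← smul_add, ← smul_sub, smul_comm _ r]
  rfl

theorem conjOp_complexifyOp (A : U →ₗ[ℝ] U) : conjOp (complexifyOp A) = complexifyOp A := by
  refine ext_ctmul fun z u => ?_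
  rw [conjOp_apply, conjU_ctmul, complexifyOp_ctmul, conjU_ctmul, Complex.conj_conj,
    complexifyOp_ctmul]

/-- Transposition of tensors is the real structure on the Hermitian operators. -/
theorem conjOp_hermOp (t : U ⊗[ℝ] U) : conjOp (hermOp U t) = hermOp U (swap U t) := by
  rw [hermOp, conjOp_add, conjOp_smul, conjOp_smul, conjOp_complexifyOp, conjOp_complexifyOp,
    hermOp, swap_swap, add_comm (swap U t), ← neg_sub t, map_neg, map_neg, smul_neg, ← neg_smul,
    map_div₀, map_div₀, map_one, Complex.conj_I, map_ofNat, neg_div]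

theorem hermOp_tensorSq {d : ℕ} {G : Subgroup (Orth d)} (θ : G →* (U ≃ₗᵢ[ℝ] U)) (g : G)
    (t : U ⊗[ℝ] U) : hermOp U (tensorSq θ g t) =
      complexifyOp (θ g).toLinearEquiv.toLinearMap ∘L hermOp U t ∘L
        complexifyOp (θ g⁻¹).toLinearEquiv.toLinearMap := by
  refine ext_ctmul fun z u => ?_
  have h : ∀ s, tensorOp U (tensorSq θ g s) u = θ g (tensorOp U s (θ g⁻¹ u)) := fun s => by
    rw [map_inv]
    exact tensorOp_map (θ g) s u
  rw [hermOp_ctmul, swap_tensorSq, ← map_add, ← map_sub, h, h]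
  simp only [ContinuousLinearMap.comp_apply, complexifyOp_ctmul, hermOp_ctmul, map_add, map_smul]
  rfl

theorem rankOne_eq_hermOp (a b : U) :
    InnerProductSpace.rankOne ℂ (ofReal a + Complex.I • ofReal b) (ofReal a + Complex.I • ofReal b)
      = hermOp U (a ⊗ₜ a + b ⊗ₜ b + a ⊗ₜ b - b ⊗ₜ a) := by
  refine ext_ctmul fun z u => ?_
  have hsw : ∀ x y : U, swap U (x ⊗ₜ y) = y ⊗ₜ x := fun _ _ => rfl
  rw [hermOp_ctmul, InnerProductSpace.rankOne_apply]
  simp only [map_add, map_sub, hsw, LinearMap.add_apply, LinearMap.sub_apply, tensorOp_tmul,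
    inner_add_left, inner_smul_left, inner_eq_hermForm, ofReal, hermForm_ctmul,
    ctmul_add, ctmul_sub, ctmul_smul]
  simp only [ctmul_eq_smul z, ctmul_eq_smul 1, map_one, one_mul, one_smul, Complex.conj_I]
  match_scalars <;> ring_nf
  simp

/-- A nonnegative operator `C` is the sum of the rank one operators given by the images of an
orthonormal basis under the square root of `C`. -/
theorem eq_sum_rankOne_sqrt {ι : Type*} [Fintype ι] (e : OrthonormalBasis ι ℂ (Complexification U))
    {C : Complexification U →L[ℂ] Complexification U} (hC : 0 ≤ C) :
    C = ∑ i, InnerProductSpace.rankOne ℂ (CFC.sqrt C (e i)) (CFC.sqrt C (e i)) := by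
  have hs : CFC.sqrt C * CFC.sqrt C = C := CFC.sqrt_mul_sqrt_self C hC
  have hsa : ∀ v w, inner ℂ (CFC.sqrt C v) w = inner ℂ v (CFC.sqrt C w) :=
    ((ContinuousLinearMap.nonneg_iff_isPositive _).1 (CFC.sqrt_nonneg C)).isSymmetric
  ext v
  conv_lhs => rw [← hs, mul_apply_eq_comp, ← e.sum_repr' (CFC.sqrt C v)]
  simp [hsa]

/-- Every nonnegative operator comes from a tensor of rank two, since this holds for the rank one
operators `rankOne (a + i b) (a + i b)`. -/
theorem exists_eq_hermOp {C : Complexification U →L[ℂ] Complexification U} (hC : C.IsPositive) :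
    ∃ t, C = hermOp U t := by
  have hr : ∀ v : Complexification U, ∃ t, InnerProductSpace.rankOne ℂ v v = hermOp U t := by
    intro v
    obtain ⟨a, b, rfl⟩ := exists_eq_add_I_smul v
    exact ⟨_, rankOne_eq_hermOp a b⟩
  let e := stdOrthonormalBasis ℂ (Complexification U)
  choose t ht using fun i => hr (CFC.sqrt C (e i))
  let h : (U ⊗[ℝ] U) →+ (Complexification U →L[ℂ] Complexification U) :=
    AddMonoidHom.mk' (hermOp U) hermOp_add
  refine ⟨∑ i, t i, ?_⟩
  rw [eq_sum_rankOne_sqrt e ((ContinuousLinearMap.nonneg_iff_isPositive _).2 hC)]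
  simp only [ht]
  exact (map_sum h t _).symm

end Conjugation

/-! ### The action of the orthogonal group on wavenumbers and on operators -/

section Rotations

variable {d : ℕ}

theorem rot_one (x : Space d) : rot (1 : Orth d) x = x := by
  simp [rot, Matrix.toEuclideanLin]

theorem rot_mul (g h : Orth d) (x : Space d) : rot (g * h) x = rot g (rot h x) := by
  simp [rot, Matrix.toEuclideanLin, Matrix.toLpLin_apply, Matrix.mulVec_mulVec]

theorem rot_neg_one (x : Space d) : rot (-1 : Orth d) x = -x := by
  have h : ((-1 : Orth d) : Matrix (Fin d) (Fin d) ℝ) = -1 := rfl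
  ext i
  simp [rot, Matrix.toEuclideanLin, h]

theorem inner_rot_left (g : Orth d) (x y : Space d) :
    inner ℝ (rot g x) y = inner ℝ x (rot g⁻¹ y) := by
  have h := Matrix.toEuclideanLin_conjTranspose_eq_adjoint (g : Matrix (Fin d) (Fin d) ℝ)
  have h' : rot g⁻¹ = LinearMap.adjoint (rot g) := h
  rw [h', LinearMap.adjoint_inner_right]

/-- The isometry of `ℝ^d` given by an orthogonal matrix. -/
def rotIso (g : Orth d) : Space d ≃ₗᵢ[ℝ] Space d :=
  LinearEquiv.isometryOfInner
    { rot g with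
      invFun := rot g⁻¹
      left_inv := fun x => by
        change rot g⁻¹ (rot g x) = x
        rw [← rot_mul, inv_mul_cancel, rot_one]
      right_inv := fun x => by
        change rot g (rot g⁻¹ x) = x
        rw [← rot_mul, mul_inv_cancel, rot_one] }
    fun x y => by
      change inner ℝ (rot g x) (rot g y) = _
      rw [inner_rot_left, ← rot_mul, inv_mul_cancel, rot_one]

theorem map_rotIso_symm_apply {V : Type*} [AddCommMonoid V] [TopologicalSpace V]
    (F : VectorMeasure (Space d) V) (g : Orth d) {A : Set (Space d)} (hA : MeasurableSet A) :
    F.map (rotIso g).symm A = F (rot g '' A) := by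
  rw [VectorMeasure.map_apply _ (rotIso g).symm.continuous.measurable hA]
  congr 1
  exact ((rotIso g).toEquiv.image_eq_preimage_symm A).symm

theorem measurableSet_rot_image (g : Orth d) {A : Set (Space d)} (hA : MeasurableSet A) :
    MeasurableSet (rot g '' A) :=
  (rotIso g).toHomeomorph.measurableEmbedding.measurableSet_image.2 hA

variable {U : Type*} [NormedAddCommGroup U] [InnerProductSpace ℝ U] [FiniteDimensional ℝ U]
  {G : Subgroup (Orth d)} (θ : G →* (U ≃ₗᵢ[ℝ] U))

/-- The action `C ↦ θ(g) C θ(g)⁻¹` of `G` on the operators on `cU`. -/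
def actOp (g : G) : (Complexification U →L[ℂ] Complexification U) →L[ℂ]
    (Complexification U →L[ℂ] Complexification U) :=
  (ContinuousLinearMap.compL ℂ _ _ _ (complexifyOp (θ g).toLinearEquiv.toLinearMap)) ∘L
    ((ContinuousLinearMap.compL ℂ _ _ _).flip (complexifyOp (θ g⁻¹).toLinearEquiv.toLinearMap))

theorem actOp_apply (g : G) (C : Complexification U →L[ℂ] Complexification U) :
    actOp θ g C = complexifyOp (θ g).toLinearEquiv.toLinearMap ∘L C ∘L
        complexifyOp (θ g⁻¹).toLinearEquiv.toLinearMap := rfl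

theorem actOp_hermOp (g : G) (t : U ⊗[ℝ] U) : actOp θ g (hermOp U t) = hermOp U (tensorSq θ g t) :=
  (hermOp_tensorSq θ g t).symm

/-! ### Reformulation of the conditions on the spectral measure -/

/-- The conditions on the spectral measure, in terms of operators: `F` is nonnegative, compatible
with the real structure, and equivariant under `G`. -/
structure IsAdmissible (F : VectorMeasure (Space d) (Complexification U →L[ℂ] Complexification U)) :
    Prop where
  isPositive : ∀ A, MeasurableSet A → (F A).IsPositive
  conj : ∀ A, MeasurableSet A → F (rot (-1 : Orth d) '' A) = conjOp (F A)
  equivariant : ∀ (g : G) A, MeasurableSet A → F (rot g.1 '' A) = actOp θ g (F A)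

variable {θ} {F : VectorMeasure (Space d) (Complexification U →L[ℂ] Complexification U)}

/-- The element `-I` of `G̃` acts on `Ũ` as the transposition, whether it belongs to `G` or not. -/
theorem IsAdmissible.of_tilde (hI : ∀ h : (-1 : Orth d) ∈ G, tensorSq θ ⟨-1, h⟩ = LinearMap.id)
    (h : TakesTildeValues G F) (h' : IsTildeEquivariant θ F) : IsAdmissible θ F where
  isPositive A hA := (h A hA).2
  equivariant g A hA := by
    obtain ⟨⟨t, ht⟩, -⟩ := h A hA
    have := h' ⟨g, Or.inl g.2⟩ A hA t ht
    rw [this, ht, actOp_hermOp]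
    change hermOp U (tildeAct θ ⟨g, Or.inl g.2⟩ (t : U ⊗[ℝ] U)) = _
    rw [tildeAct_of_mem θ g.2]
  conj A hA := by
    obtain ⟨⟨t, ht⟩, -⟩ := h A hA
    have hm : (-1 : Orth d) ∈ tildeG G := Or.inr ⟨1, G.one_mem, by simp⟩
    have := h' ⟨-1, hm⟩ A hA t ht
    rw [this, ht, conjOp_hermOp]
    change hermOp U (tildeAct θ ⟨-1, hm⟩ (t : U ⊗[ℝ] U)) = _
    by_cases hG : (-1 : Orth d) ∈ G
    · have ht' : (t : U ⊗[ℝ] U) ∈ symTensors U := by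
        have hU : tildeU U G = symTensors U := if_pos hG
        exact hU ▸ t.2
      rw [tildeAct_of_mem θ (g := ⟨-1, hm⟩) hG, hI hG]
      exact congrArg _ (show swap U (t : U ⊗[ℝ] U) = t from ht').symm
    · rw [tildeAct_of_notMem θ (g := ⟨-1, hm⟩) hG, LinearMap.comp_apply]
      have h1 : (⟨-(-1 : Orth d), neg_mem_of_mem_tildeG hm hG⟩ : G) = 1 := by
        ext1; simp
      rw [h1, tensorSq_one]
      rfl

/-- A nonnegative operator commuting with the conjugation comes from a symmetric tensor. -/
theorem exists_eq_hermOp_of_conjOp_eq {C : Complexification U →L[ℂ] Complexification U}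
    (hC : C.IsPositive) (h : conjOp C = C) : ∃ t ∈ symTensors U, C = hermOp U t := by
  obtain ⟨t, rfl⟩ := exists_eq_hermOp hC
  refine ⟨(1 / 2 : ℝ) • (t + swap U t), ?_, ?_⟩
  · change swap U _ = _
    rw [map_smul, map_add, swap_swap, add_comm]
    rfl
  · rw [hermOp_smul, hermOp_add, ← conjOp_hermOp, h, ← two_smul ℂ, smul_smul]
    simp

/-- If `-I` belongs to `G`, equivariance under `-I` and compatibility with the real structure force
the values to be real, hence to come from symmetric tensors. -/
theorem IsAdmissible.takesTildeValues (h : IsAdmissible θ F)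
    (hI : ∀ h : (-1 : Orth d) ∈ G, tensorSq θ ⟨-1, h⟩ = LinearMap.id) : TakesTildeValues G F := by
  intro A hA
  refine ⟨?_, h.isPositive A hA⟩
  by_cases hG : (-1 : Orth d) ∈ G
  · have hconj : conjOp (F A) = F A := by
      obtain ⟨t, ht⟩ := exists_eq_hermOp (h.isPositive A hA)
      rw [← h.conj A hA, h.equivariant ⟨-1, hG⟩ A hA, ht, actOp_hermOp, hI hG, LinearMap.id_apply]
    obtain ⟨t, ht, hFt⟩ := exists_eq_hermOp_of_conjOp_eq (h.isPositive A hA) hconj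
    exact ⟨⟨t, by rwa [tildeU, if_pos hG]⟩, hFt⟩
  · obtain ⟨t, ht⟩ := exists_eq_hermOp (h.isPositive A hA)
    exact ⟨⟨t, by rw [tildeU, if_neg hG]; trivial⟩, ht⟩

theorem IsAdmissible.isTildeEquivariant (h : IsAdmissible θ F) : IsTildeEquivariant θ F := by
  intro g A hA t ht
  change F (rot g.1 '' A) = hermOp U (tildeAct θ g (t : U ⊗[ℝ] U))
  by_cases hg : (g : Orth d) ∈ G
  · rw [tildeAct_of_mem θ hg, h.equivariant ⟨g, hg⟩ A hA, ht, actOp_hermOp]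
  · have hg' := neg_mem_of_mem_tildeG g.2 hg
    have himage : rot g.1 '' A = rot (-g.1) '' (rot (-1 : Orth d) '' A) := by
      rw [Set.image_image]
      simp only [← rot_mul, mul_neg, mul_one, neg_neg]
    rw [tildeAct_of_notMem θ hg, LinearMap.comp_apply, himage,
      h.equivariant ⟨-g.1, hg'⟩ _ (measurableSet_rot_image _ hA), h.conj A hA, ht, conjOp_hermOp,
      actOp_hermOp]

/-- Admissibility in terms of the Fourier transform. The real structure is conjugate-linear, so on
the side of measures it comes with the reflection `k ↦ -k`. -/
theorem IsAdmissible.of_fourier (hpos : ∀ A, MeasurableSet A → (F A).IsPositive)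
    (hconj : ∀ x, conjOp (fourier F x) = fourier F x)
    (heq : ∀ (g : G) x, fourier F (rot g.1 x) = actOp θ g (fourier F x)) : IsAdmissible θ F where
  isPositive := hpos
  conj A hA := by
    have := ext_of_fourier (F := F.map (rotIso (-1 : Orth d)).symm)
      (F' := F.mapRange
        ((conjOpCLM : _ →L[ℝ] (Complexification U →L[ℂ] Complexification U)) : _ →+ _)
        conjOpCLM.continuous) fun x => by
      rw [fourier_mapRange_conj F conjOpCLM (fun a C => conjOp_smul a C), fourier_map]
      change fourier F (rot _ x) = conjOp _
      rw [rot_neg_one, hconj]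
    rw [← map_rotIso_symm_apply F _ hA, this]
    rfl
  equivariant g A hA := by
    have := ext_of_fourier (F := F.map (rotIso g.1).symm)
      (F' := F.mapRange ((actOp θ g).restrictScalars ℝ : _ →+ _)
        ((actOp θ g).restrictScalars ℝ).continuous) fun x => by
      rw [fourier_mapRange F ((actOp θ g).restrictScalars ℝ) (fun a C => map_smul (actOp θ g) a C),
        fourier_map]
      exact heq g x
    rw [← map_rotIso_symm_apply F _ hA, this]
    rfl

theorem IsAdmissible.conjOp_fourier (h : IsAdmissible θ F) (x : Space d) :
    conjOp (fourier F x) = fourier F x := by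
  have hF : F.map (rotIso (-1 : Orth d)).symm =
      F.mapRange ((conjOpCLM : _ →L[ℝ] (Complexification U →L[ℂ] Complexification U)) : _ →+ _)
        conjOpCLM.continuous := by
    ext A hA : 1
    rw [map_rotIso_symm_apply F _ hA, h.conj A hA]
    rfl
  have h1 := fourier_mapRange_conj F conjOpCLM (fun a C => conjOp_smul a C) (-x)
  rw [← hF, fourier_map, neg_neg] at h1
  change fourier F (rot _ (-x)) = conjOp _ at h1
  rw [← h1, rot_neg_one, neg_neg]

theorem IsAdmissible.fourier_rot (h : IsAdmissible θ F) (g : G) (x : Space d) :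
    fourier F (rot g.1 x) = actOp θ g (fourier F x) := by
  have hF : F.map (rotIso g.1).symm = F.mapRange ((actOp θ g).restrictScalars ℝ : _ →+ _)
        ((actOp θ g).restrictScalars ℝ).continuous := by
    ext A hA : 1
    rw [map_rotIso_symm_apply F _ hA, h.equivariant g A hA]
    rfl
  have h1 := fourier_mapRange F ((actOp θ g).restrictScalars ℝ)
    (fun a C => map_smul (actOp θ g) a C) x
  rw [← hF, fourier_map] at h1
  exact h1

end Rotations

/-! ### Two-point correlation tensors -/

section TwoPoint

variable {d : ℕ} {U : Type*} [NormedAddCommGroup U] [InnerProductSpace ℝ U]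
  {Ω : Type*} [MeasurableSpace Ω] {P : Measure Ω} {T : Space d → Ω → Complexification U}

theorem integrable_rankOne {E : Type*} [NormedAddCommGroup E] [InnerProductSpace ℂ E]
    {X Y : Ω → E} (hX : MemLp X 2 P) (hY : MemLp Y 2 P) :
    Integrable (fun ω => InnerProductSpace.rankOne ℂ (Y ω) (X ω)) P := by
  have hc : Continuous fun p : E × E => (innerSL ℂ p.2).smulRight p.1 :=
    (ContinuousLinearMap.smulRightL ℂ E E).continuous₂.comp
      (((innerSL ℂ).continuous.comp continuous_snd).prodMk continuous_fst)
  have hm : AEStronglyMeasurable (fun ω => InnerProductSpace.rankOne ℂ (Y ω) (X ω)) P :=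
    hc.comp_aestronglyMeasurable (f := fun ω => (Y ω, X ω)) (hY.1.prodMk hX.1)
  have hg : Integrable (fun ω => ‖Y ω‖ * ‖X ω‖) P := hY.norm.integrable_mul hX.norm
  refine Integrable.mono' hg hm (ae_of_all _ fun ω => ?_)
  rw [InnerProductSpace.norm_rankOne]

variable [FiniteDimensional ℝ U]

/-- The two-point correlation tensor of a `U`-valued field is real. -/
theorem conjOp_twoPoint_asComplex {S : Space d → Ω → U} (hS : IsCentredField P (asComplex S))
    (x y : Space d) : conjOp (twoPoint P (asComplex S) x y) = twoPoint P (asComplex S) x y := by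
  rw [twoPoint, ← conjOpCLM_apply, ← conjOpCLM.integral_comp_comm
    (integrable_rankOne (hS.secondOrder x) (hS.secondOrder y))]
  simp only [conjOpCLM_apply, conjOp_rankOne, asComplex, conjU_ofReal]

variable {F : VectorMeasure (Space d) (Complexification U →L[ℂ] Complexification U)}

theorem isSpectralMeasure_iff :
    IsSpectralMeasure P T F ↔ ∀ x y, twoPoint P T x y = fourier F (y - x) := Iff.rfl

open scoped ComplexOrder in
/-- The spectral measure of a random field is nonnegative: for each vector `v`, the double sums
which express positive definiteness of the Fourier transform of `A ↦ (v, F(A) v)` are the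
expectations of `|∑ c(x) (v, T(x))|²`. -/
theorem isPositive_of_isSpectralMeasure (hT : IsCentredField P T) (h : IsSpectralMeasure P T F)
    {A : Set (Space d)} (hA : MeasurableSet A) : (F A).IsPositive := by
  rw [ContinuousLinearMap.isPositive_iff_complex]
  intro v
  let ℓ : (Complexification U →L[ℂ] Complexification U) →L[ℂ] ℂ :=
    (innerSL ℂ v) ∘L (ContinuousLinearMap.apply ℂ (Complexification U) v)
  have hℓ : ∀ C, ℓ C = inner ℂ v (C v) := fun C => rfl
  have hint : ∀ x y, Integrable (fun ω => inner ℂ (T x ω) v * inner ℂ v (T y ω)) P := fun x y => by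
    refine (ℓ.integrable_comp (integrable_rankOne (hT.secondOrder x) (hT.secondOrder y))).congr
      (ae_of_all _ fun ω => ?_)
    simp [hℓ]
  have hval : ∀ x y, ℓ (fourier F (y - x)) = ∫ ω, inner ℂ (T x ω) v * inner ℂ v (T y ω) ∂P :=
    fun x y => by
      rw [← isSpectralMeasure_iff.1 h x y, twoPoint, ← ℓ.integral_comp_comm
        (integrable_rankOne (hT.secondOrder x) (hT.secondOrder y))]
      simp [hℓ]
  have hpos := nonneg_of_fourier_posDef
    (F.mapRange (ℓ.restrictScalars ℝ : _ →+ _) (ℓ.restrictScalars ℝ).continuous) (fun c => by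
      have hsum : (c.sum fun x a => c.sum fun y b => (starRingEnd ℂ) a * b *
          ℓ (fourier F (y - x))) =
          ∫ ω, (starRingEnd ℂ) (∑ x ∈ c.support, c x * inner ℂ v (T x ω)) *
            (∑ y ∈ c.support, c y * inner ℂ v (T y ω)) ∂P := by
        have hint' : ∀ x y, Integrable (fun ω => (starRingEnd ℂ) (c x * inner ℂ v (T x ω)) *
            (c y * inner ℂ v (T y ω))) P := fun x y => by
          refine ((hint x y).const_mul ((starRingEnd ℂ) (c x) * c y)).congr
            (ae_of_all _ fun ω => ?_)
          simp only [map_mul, inner_conj_symm]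
          ring
        simp only [hval, Finsupp.sum, ← integral_const_mul]
        simp_rw [map_sum, Finset.sum_mul_sum]
        rw [integral_finsetSum _ fun x _ => integrable_finsetSum _ fun y _ => hint' x y]
        refine Finset.sum_congr rfl fun x _ => ?_
        rw [integral_finsetSum _ fun y _ => hint' x y]
        refine Finset.sum_congr rfl fun y _ => integral_congr_ae (ae_of_all _ fun ω => ?_)
        simp only [map_mul, inner_conj_symm]
        ring
      simp only [fourier_mapRange F (ℓ.restrictScalars ℝ) (fun a C => map_smul ℓ a C)]
      refine le_of_le_of_eq ?_ hsum.symm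
      refine integral_nonneg fun ω => ?_
      simp only [Pi.zero_apply]
      exact star_mul_self_nonneg _) hA
  have hpos' : 0 ≤ inner ℂ v (F A v) := hpos
  have hz : inner ℂ (F A v) v = inner ℂ v (F A v) := by
    rw [← inner_conj_symm]
    exact Complex.conj_eq_iff_im.2 (Complex.nonneg_iff.1 hpos').2.symm
  rw [hz]
  exact ⟨(RCLike.nonneg_iff_exists_ofReal.1 hpos').elim fun r hr => by simp [← hr.2],
    (Complex.nonneg_iff.1 hpos').1⟩

variable {G : Subgroup (Orth d)} {θ : G →* (U ≃ₗᵢ[ℝ] U)}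

/-- A centred field whose spectral measure is admissible is homogeneous and isotropic. -/
theorem IsAdmissible.isHomogeneous_and_isIsotropic (hF : IsAdmissible θ F)
    (hT : IsCentredField P T) (h : IsSpectralMeasure P T F) :
    IsHomogeneous P T ∧ IsIsotropic θ P T := by
  rw [isSpectralMeasure_iff] at h
  refine ⟨⟨fun x z => by rw [hT.centred, hT.centred], fun x y z => ?_⟩,
    ⟨fun g x => by rw [hT.centred, hT.centred, map_zero], fun g x y => ?_⟩⟩
  · rw [h, h, add_sub_add_right_eq_sub]
  · rw [h, h, ← map_sub, hF.fourier_rot, actOp_apply]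

/-- The spectral measure of an isotropic field with real two-point correlation tensor is
admissible. -/
theorem isAdmissible_of_isSpectralMeasure (hT : IsCentredField P T) (h : IsSpectralMeasure P T F)
    (hreal : ∀ x y, conjOp (twoPoint P T x y) = twoPoint P T x y) (hiso : IsIsotropic θ P T) :
    IsAdmissible θ F := by
  have h' := isSpectralMeasure_iff.1 h
  refine IsAdmissible.of_fourier (fun A hA => isPositive_of_isSpectralMeasure hT h hA)
    (fun x => ?_) fun g x => ?_
  · simpa only [h', sub_zero] using hreal 0 x
  · have := hiso.2 g 0 x
    rwa [map_zero, h', h', sub_zero, sub_zero] at this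

end TwoPoint

/-! ### Nonnegative operator-valued densities -/

section Density

variable {X : Type*} [MeasurableSpace X]
  {E : Type*} [NormedAddCommGroup E] [InnerProductSpace ℂ E] [FiniteDimensional ℂ E]

/-- The density of a vector measure with nonnegative operator values is almost everywhere
nonnegative: it suffices to test the defining (in)equalities of positivity on a dense sequence of
vectors. -/
theorem ae_nonneg_of_withDensity {μ : Measure X} {f : X → E →L[ℂ] E} (hf : Integrable f μ)
    (hpos : ∀ A, MeasurableSet A → (μ.withDensityᵥ f A).IsPositive) : ∀ᵐ x ∂μ, 0 ≤ f x := by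
  have key : ∀ ℓ : (E →L[ℂ] E) →L[ℝ] ℝ, (∀ C : E →L[ℂ] E, C.IsPositive → 0 ≤ ℓ C) →
      ∀ᵐ x ∂μ, 0 ≤ ℓ (f x) := fun ℓ hℓ => by
    refine ae_nonneg_of_forall_setIntegral_nonneg (ℓ.integrable_comp hf) fun A hA _ => ?_
    rw [ℓ.integral_comp_comm hf.integrableOn, ← withDensityᵥ_apply hf hA]
    exact hℓ _ (hpos A hA)
  let q : E → (E →L[ℂ] E) →L[ℝ] ℂ := fun v => ((innerSL ℂ v) ∘L
    (ContinuousLinearMap.apply ℂ E v)).restrictScalars ℝ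
  have hq : ∀ C : E →L[ℂ] E, C.IsPositive → ∀ v, 0 ≤ (q v C).re ∧ (q v C).im = 0 :=
    fun C hC v => by
      have := hC.inner_nonneg_right v
      exact ⟨(Complex.nonneg_iff.1 this).1, (Complex.nonneg_iff.1 this).2.symm⟩
  have : SecondCountableTopology E := by
    have := FiniteDimensional.proper ℂ E
    infer_instance
  have h : ∀ᵐ x ∂μ, ∀ n, 0 ≤ (q (TopologicalSpace.denseSeq E n) (f x)).re ∧
      (q (TopologicalSpace.denseSeq E n) (f x)).im = 0 := by
    refine ae_all_iff.2 fun n => ?_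
    filter_upwards [key (Complex.reCLM ∘L q (TopologicalSpace.denseSeq E n))
        fun C hC => (hq C hC _).1,
      key (Complex.imCLM ∘L q (TopologicalSpace.denseSeq E n)) fun C hC => (hq C hC _).2.ge,
      key (-(Complex.imCLM ∘L q (TopologicalSpace.denseSeq E n)))
        fun C hC => (neg_eq_zero.2 (hq C hC _).2).ge] with x h1 h2 h3
    exact ⟨h1, le_antisymm (neg_nonneg.1 h3) h2⟩
  filter_upwards [h] with x hx
  rw [ContinuousLinearMap.nonneg_iff_isPositive, ContinuousLinearMap.isPositive_iff_complex]
  have hcont : Continuous fun v => q v (f x) := continuous_id.inner (f x).continuous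
  have hclosed : IsClosed {v : E | 0 ≤ (q v (f x)).re ∧ (q v (f x)).im = 0} :=
    (isClosed_le continuous_const (Complex.continuous_re.comp hcont)).inter
      (isClosed_eq (Complex.continuous_im.comp hcont) continuous_const)
  intro v
  obtain ⟨h1, h2⟩ := isClosed_property (TopologicalSpace.denseRange_denseSeq E) hclosed hx v
  have hz : inner ℂ (f x v) v = ((q v (f x)).re : ℂ) := by
    rw [← inner_conj_symm]
    change (starRingEnd ℂ) (q v (f x)) = _
    rw [Complex.conj_eq_iff_im.2 h2, ← Complex.re_add_im (q v (f x)), h2]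
    simp
  rw [hz]
  exact ⟨by simp, by simpa using h1⟩

theorem exists_isProbabilityMeasure_absolutelyContinuous [Nonempty X] (ν : Measure X)
    [IsFiniteMeasure ν] : ∃ μ : Measure X, IsProbabilityMeasure μ ∧ ν ≪ μ := by
  -- The point mass makes the sum nonzero even if `ν = 0`.
  let ν' : Measure X := ν + Measure.dirac (Classical.arbitrary X)
  have : NeZero ν' := ⟨fun h => by simpa [ν'] using congrArg (fun m : Measure X => m Set.univ) h⟩
  refine ⟨(ν' Set.univ)⁻¹ • ν', isProbabilityMeasureSMul, ?_⟩
  exact (Measure.absolutelyContinuous_of_le (Measure.le_add_right le_rfl)).trans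
    (Measure.absolutelyContinuous_smul (ENNReal.inv_ne_zero.2 (measure_ne_top ν' _)))

theorem measurableSet_nonneg {f : X → E →L[ℂ] E} (hf : StronglyMeasurable f) :
    MeasurableSet {x | 0 ≤ f x} := by
  borelize (E →L[ℂ] E)
  exact hf.measurable (CStarAlgebra.isClosed_nonneg (A := E →L[ℂ] E)).measurableSet

/-- The Radon–Nikodym theorem relative to a suitable probability measure. -/
theorem exists_isProbabilityMeasure_eq_withDensity [Nonempty X] {V : Type*} [NormedAddCommGroup V]
    [NormedSpace ℝ V] [FiniteDimensional ℝ V] (F : VectorMeasure X V) :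
    ∃ (μ : Measure X) (_ : IsProbabilityMeasure μ) (f : X → V),
      StronglyMeasurable f ∧ Integrable f μ ∧ F = μ.withDensityᵥ f := by
  have : IsFiniteMeasure F.variation := isFiniteMeasure_variation F
  obtain ⟨μ, hprob, hμ⟩ := exists_isProbabilityMeasure_absolutelyContinuous F.variation
  exact ⟨μ, hprob, exists_eq_withDensity F μ hμ⟩

/-- A vector measure with nonnegative operator values has, relative to some probability measure,
a measurable density with nonnegative values. -/
theorem exists_nonneg_density [Nonempty X] (F : VectorMeasure X (E →L[ℂ] E))
    (hpos : ∀ A, MeasurableSet A → (F A).IsPositive) :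
    ∃ (μ : Measure X) (_ : IsProbabilityMeasure μ) (f : X → E →L[ℂ] E), StronglyMeasurable f ∧
      (∀ x, 0 ≤ f x) ∧ Integrable f μ ∧ F = μ.withDensityᵥ f := by
  have : FiniteDimensional ℝ (E →L[ℂ] E) := FiniteDimensional.trans ℝ ℂ (E →L[ℂ] E)
  obtain ⟨μ, hprob, f, hf, hi, hF⟩ :=
    exists_isProbabilityMeasure_eq_withDensity (V := E →L[ℂ] E) F
  have h0 : ∀ᵐ x ∂μ, 0 ≤ f x := by
    refine ae_nonneg_of_withDensity hi fun A hA => ?_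
    rw [← hF]
    exact hpos A hA
  have hae : f =ᵐ[μ] {x | 0 ≤ f x}.indicator f :=
    h0.mono fun x hx => (Set.indicator_of_mem (s := {x | 0 ≤ f x}) hx f).symm
  refine ⟨μ, hprob, {x | 0 ≤ f x}.indicator f, hf.indicator (measurableSet_nonneg hf),
    fun x => ?_, hi.congr hae, hF.trans (WithDensityᵥEq.congr_ae hae)⟩
  by_cases hx : x ∈ {x | 0 ≤ f x}
  · rw [Set.indicator_of_mem hx]
    exact hx
  · rw [Set.indicator_of_notMem hx]

theorem stronglyMeasurable_sqrt {f : X → E →L[ℂ] E} (hf : StronglyMeasurable f)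
    (h0 : ∀ x, 0 ≤ f x) : StronglyMeasurable fun x => CFC.sqrt (f x) := by
  borelize (E →L[ℂ] E)
  have : SecondCountableTopology (E →L[ℂ] E) := by
    have := FiniteDimensional.proper ℂ (E →L[ℂ] E)
    infer_instance
  have h := (continuousOn_iff_continuous_domRestrict.1
    (CFC.continuousOn_sqrt (A := E →L[ℂ] E))).measurable
  exact (h.comp (hf.measurable.subtype_mk (h := h0))).stronglyMeasurable

end Density

/-! ### Mixtures over a finite index set -/

section Mixture

universe w

variable {X : Type} [MeasurableSpace X] (ι : Type) [Fintype ι] [MeasurableSpace ι]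
  [DiscreteMeasurableSpace ι]

/-- The law of a pair of independent variables, one with distribution `μ` and one uniformly
distributed on the finite set `ι`. It is lifted to an arbitrary universe. -/
def uniformMixture (μ : Measure X) : Measure (ULift.{w} (X × ι)) :=
  ∑ i, (Fintype.card ι : ENNReal)⁻¹ • μ.map fun x => ULift.up (x, i)

variable {ι}

theorem measurableEmbedding_mk (i : ι) :
    MeasurableEmbedding fun x : X => (ULift.up (x, i) : ULift.{w} (X × ι)) :=
  MeasurableEquiv.ulift.symm.measurableEmbedding.comp (measurableEmbedding_prod_mk_right i)

instance [Nonempty ι] (μ : Measure X) [IsProbabilityMeasure μ] :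
    IsProbabilityMeasure (uniformMixture.{w} ι μ) := by
  refine ⟨?_⟩
  have h : ∀ i : ι, μ.map (fun x => (ULift.up (x, i) : ULift.{w} (X × ι))) Set.univ = 1 :=
    fun i => by
      rw [Measure.map_apply (measurableEmbedding_mk i).measurable .univ, Set.preimage_univ,
        measure_univ]
  simp only [uniformMixture, Measure.coe_finsetSum, Finset.sum_apply, Measure.smul_apply, h,
    smul_eq_mul, mul_one, Finset.sum_const, Finset.card_univ, nsmul_eq_mul]
  exact ENNReal.mul_inv_cancel (by simp) (by simp)

variable {W : Type*} [NormedAddCommGroup W] {μ : Measure X} {g : ULift.{w} (X × ι) → W}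

theorem integrable_uniformMixture (hg : ∀ i, Integrable (fun x => g (ULift.up (x, i))) μ) :
    Integrable g (uniformMixture.{w} ι μ) := by
  rcases isEmpty_or_nonempty ι with h | h
  · simp [uniformMixture]
  refine integrable_finsetSum_measure.2 fun i _ => Integrable.smul_measure ?_ (by simp)
  exact (measurableEmbedding_mk i).integrable_map_iff.2 (hg i)

theorem integral_uniformMixture [NormedSpace ℝ W]
    (hg : ∀ i, Integrable (fun x => g (ULift.up (x, i))) μ) :
    ∫ ω, g ω ∂(uniformMixture.{w} ι μ) =
      (Fintype.card ι : ℝ)⁻¹ • ∑ i, ∫ x, g (ULift.up (x, i)) ∂μ := by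
  rcases isEmpty_or_nonempty ι with h | h
  · simp [uniformMixture]
  rw [uniformMixture, integral_finsetSum_measure fun i _ => Integrable.smul_measure
    ((measurableEmbedding_mk i).integrable_map_iff.2 (hg i)) (by simp), Finset.smul_sum]
  refine Finset.sum_congr rfl fun i _ => ?_
  rw [integral_smul_measure, (measurableEmbedding_mk i).integral_map]
  simp

end Mixture

/-! ### A real random field with a prescribed spectral measure -/

section Construction

universe w

variable {d : ℕ} {U : Type*} [NormedAddCommGroup U] [InnerProductSpace ℝ U]
  {ι : Type}

/-- The real random field `re (exp (i (k, x)) v_i(k))`, where the wavevector `k` and the index `i`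
are random. -/
def waveField (v : ι → Space d → Complexification U) (x : Space d)
    (ω : ULift.{w} (Space d × ι)) : U :=
  realPart (character x ω.down.1 • v ω.down.2 ω.down.1)

theorem asComplex_waveField (v : ι → Space d → Complexification U) (x k : Space d) (i : ι) :
    asComplex (waveField.{w} v) x (ULift.up (k, i)) = ofReal (realPart (character x k • v i k)) :=
  rfl

theorem continuous_ofReal_realPart [FiniteDimensional ℝ U] :
    Continuous fun v : Complexification U => ofReal (realPart v) := by
  simp_rw [ofReal_realPart]
  exact (continuous_id.add (conjCLM (U := U)).continuous).const_smul (1 / 2 : ℂ)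

theorem norm_wave_le (v : ι → Space d → Complexification U) (x k : Space d) (i : ι) :
    ‖ofReal (realPart (character x k • v i k))‖ ≤ ‖v i k‖ := by
  rw [norm_ofReal]
  exact (norm_realPart_le _).trans (by rw [norm_smul, norm_character, one_mul])

/-- The rank one operator of the real parts of `c a` and `c b`, for a phase `c`, by bilinear
expansion. -/
theorem rankOne_ofReal_realPart_smul {c : ℂ} (hc : c * (starRingEnd ℂ) c = 1)
    (a b : Complexification U) :
    InnerProductSpace.rankOne ℂ (ofReal (realPart (c • a))) (ofReal (realPart (c • b))) =
      (1 / 4 : ℂ) • (InnerProductSpace.rankOne ℂ a b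
        + InnerProductSpace.rankOne ℂ (conjU a) (conjU b)
        + c ^ 2 • InnerProductSpace.rankOne ℂ a (conjU b)
        + (starRingEnd ℂ) c ^ 2 • InnerProductSpace.rankOne ℂ (conjU a) b) := by
  ext u
  simp only [ofReal_realPart, add_apply, smul_apply, InnerProductSpace.rankOne_apply,
    inner_smul_left, inner_add_left, map_smulₛₗ, map_div₀, map_one, map_ofNat, Complex.conj_conj]
  set p := inner ℂ b u
  set q := inner ℂ (conjU b) u
  linear_combination (norm := module) ((1 / 4 : ℂ) * p * hc) • a + ((1 / 4 : ℂ) * q * hc) • conjU a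

/-- Averaging over the four phases `1, i, -1, -i` removes the terms in which a vector is paired
with a conjugate vector. -/
theorem sum_rankOne_phase (a b : Complexification U) :
    ∑ s : Fin 4, InnerProductSpace.rankOne ℂ (ofReal (realPart (Complex.I ^ (s : ℕ) • a)))
        (ofReal (realPart (Complex.I ^ (s : ℕ) • b))) =
      InnerProductSpace.rankOne ℂ a b + conjOp (InnerProductSpace.rankOne ℂ a b) := by
  have hc : ∀ s : ℕ, Complex.I ^ s * (starRingEnd ℂ) (Complex.I ^ s) = 1 := fun s => by
    rw [Complex.mul_conj, map_pow, Complex.normSq_I, one_pow, Complex.ofReal_one]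
  have h : ∀ s : ℕ, (Complex.I ^ s) ^ 2 = (-1) ^ s ∧
      (starRingEnd ℂ) (Complex.I ^ s) ^ 2 = (-1) ^ s := fun s => by
    rw [← map_pow, ← pow_mul, mul_comm, pow_mul, Complex.I_sq]
    simp
  simp_rw [rankOne_ofReal_realPart_smul (hc _), (h _).1, (h _).2, Fin.sum_univ_four, conjOp_rankOne]
  norm_num
  module

/-- Averaging over phases and indices turns the product of two waves with amplitudes as in
`exists_amplitude` into the sum of the density and of its image under the real structure. -/
theorem sum_rankOne_wave {m : ℕ} {r : Fin (m + 1) → Complexification U}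
    {C : Complexification U →L[ℂ] Complexification U}
    (hC : ∑ j, InnerProductSpace.rankOne ℂ (r j) (r j) = (2 * (m + 1) : ℝ) • C)
    (x y k : Space d) :
    ∑ i : Fin (m + 1) × Fin 4, InnerProductSpace.rankOne ℂ
      (ofReal (realPart (character y k • Complex.I ^ (i.2 : ℕ) • r i.1)))
      (ofReal (realPart (character x k • Complex.I ^ (i.2 : ℕ) • r i.1))) =
        (2 * (m + 1) : ℝ) • (character (y - x) k • C + conjOpCLM (character (y - x) k • C)) := by
  have h1 : ∀ j, InnerProductSpace.rankOne ℂ (character y k • r j) (character x k • r j) =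
      character (y - x) k • InnerProductSpace.rankOne ℂ (r j) (r j) := fun j => by
    simp only [map_smul, map_smulₛₗ, smul_apply, smul_smul, star_character]
    rw [character_mul, neg_add_eq_sub]
  rw [Fintype.sum_prod_type]
  simp only [smul_comm (character _ k) (Complex.I ^ _)]
  simp_rw [sum_rankOne_phase, h1, ← conjOpCLM_apply]
  rw [Finset.sum_add_distrib, ← map_sum, ← Finset.smul_sum, hC, smul_comm, map_smul, smul_add]

/-- The amplitudes `q_j`, each multiplied by the four phases `1, i, -1, -i`. -/
def withPhases {m : ℕ} (q : Fin m → Space d → Complexification U) (i : Fin m × Fin 4)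
    (k : Space d) : Complexification U :=
  Complex.I ^ (i.2 : ℕ) • q i.1 k

theorem stronglyMeasurable_withPhases {m : ℕ} {q : Fin m → Space d → Complexification U}
    (hq : ∀ j, StronglyMeasurable (q j)) (i : Fin m × Fin 4) :
    StronglyMeasurable (withPhases q i) :=
  (hq i.1).const_smul (Complex.I ^ (i.2 : ℕ))

theorem memLp_withPhases {m : ℕ} {q : Fin m → Space d → Complexification U}
    {μ : Measure (Space d)} (hq : ∀ j, MemLp (q j) 2 μ) (i : Fin m × Fin 4) :
    MemLp (withPhases q i) 2 μ :=
  (hq i.1).const_smul (Complex.I ^ (i.2 : ℕ))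

theorem sum_withPhases {m : ℕ} (q : Fin m → Space d → Complexification U) (k : Space d) :
    ∑ i, withPhases q i k = 0 := by
  rw [Fintype.sum_prod_type]
  refine Finset.sum_eq_zero fun j _ => ?_
  simp only [withPhases]
  rw [← Finset.sum_smul, Fin.sum_univ_four]
  simp [pow_succ]

variable [FiniteDimensional ℝ U] {v : ι → Space d → Complexification U} {μ : Measure (Space d)}

theorem measurable_wave (hv : ∀ i, StronglyMeasurable (v i)) (x : Space d) (i : ι) :
    Measurable fun k => ofReal (realPart (character x k • v i k)) :=
  continuous_ofReal_realPart.measurable.comp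
    ((continuous_character x).stronglyMeasurable.smul (hv i)).measurable

theorem memLp_wave (hv : ∀ i, StronglyMeasurable (v i)) (hv2 : ∀ i, MemLp (v i) 2 μ)
    (x : Space d) (i : ι) :
    MemLp (fun k => ofReal (realPart (character x k • v i k))) 2 μ := by
  have : SecondCountableTopology (Complexification U) := by
    have := FiniteDimensional.proper ℂ (Complexification U)
    infer_instance
  exact (hv2 i).mono (measurable_wave hv x i).aestronglyMeasurable
    (ae_of_all _ fun k => norm_wave_le v x k i)

variable [Fintype ι] [MeasurableSpace ι] [DiscreteMeasurableSpace ι]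

/-- If the amplitudes are square-integrable and their sum over the random index vanishes, then the
field is centred; it is mean-square continuous by dominated convergence. -/
theorem isCentredField_waveField [IsFiniteMeasure μ] (hv : ∀ i, StronglyMeasurable (v i))
    (hv2 : ∀ i, MemLp (v i) 2 μ) (hsum : ∀ k, ∑ i, v i k = 0) :
    IsCentredField (uniformMixture.{w} ι μ) (asComplex (waveField.{w} v)) := by
  have : SecondCountableTopology (Complexification U) := by
    have := FiniteDimensional.proper ℂ (Complexification U)
    infer_instance
  have hmeas : ∀ x, Measurable (asComplex (waveField.{w} v) x) := fun x => by
    have h : Measurable fun p : Space d × ι =>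
        ofReal (realPart (character x p.1 • v p.2 p.1)) :=
      measurable_from_prod_countable_left fun i => measurable_wave hv x i
    exact h.comp measurable_down
  refine ⟨hmeas, fun x => ?_, fun x => ?_, fun x => ?_⟩
  · rw [memLp_two_iff_integrable_sq_norm (hmeas x).aestronglyMeasurable]
    refine integrable_uniformMixture fun i => ?_
    exact (memLp_wave hv hv2 x i).integrable_norm_pow two_ne_zero
  · have hi : ∀ i, Integrable (fun k => ofReal (realPart (character x k • v i k))) μ :=
      fun i => (memLp_wave hv hv2 x i).integrable one_le_two
    rw [integral_uniformMixture hi]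
    simp only [asComplex_waveField]
    rw [← integral_finsetSum _ fun i _ => hi i]
    have h0 : ∀ k, ∑ i, ofReal (realPart (character x k • v i k)) = 0 := fun k => by
      simp_rw [ofReal_realPart]
      rw [← Finset.smul_sum, Finset.sum_add_distrib, ← map_sum, ← Finset.smul_sum, hsum]
      simp
    simp [h0]
  · have hi : ∀ y i, Integrable (fun k => ‖ofReal (realPart (character x k • v i k)) -
        ofReal (realPart (character y k • v i k))‖ ^ 2) μ := fun y i =>
      ((memLp_wave hv hv2 x i).sub (memLp_wave hv hv2 y i)).integrable_norm_pow two_ne_zero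
    simp_rw [fun y => integral_uniformMixture (g := fun ω =>
      ‖asComplex (waveField.{w} v) x ω - asComplex (waveField.{w} v) y ω‖ ^ 2) (hi y)]
    simp only [asComplex_waveField]
    rw [← smul_zero ((Fintype.card ι : ℝ)⁻¹), ← Finset.sum_const_zero (s := Finset.univ (α := ι))]
    refine (tendsto_finsetSum _ fun i _ => ?_).const_smul _
    rw [← integral_zero (Space d) ℝ (μ := μ)]
    refine tendsto_integral_filter_of_dominated_convergence (fun k => 4 * ‖v i k‖ ^ 2)
      (Eventually.of_forall fun y => (hi y i).1) (Eventually.of_forall fun y =>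
        ae_of_all _ fun k => ?_) (((hv2 i).integrable_norm_pow two_ne_zero).const_mul 4)
      (ae_of_all _ fun k => ?_)
    · rw [Real.norm_of_nonneg (by positivity)]
      have h := (norm_sub_le (ofReal (realPart (character x k • v i k)))
        (ofReal (realPart (character y k • v i k)))).trans
        (add_le_add (norm_wave_le v x k i) (norm_wave_le v y k i))
      calc _ ≤ (‖v i k‖ + ‖v i k‖) ^ 2 := by gcongr
        _ = _ := by ring
    · have hc : Continuous fun y => ‖ofReal (realPart (character x k • v i k)) -
          ofReal (realPart (character y k • v i k))‖ ^ 2 :=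
        ((continuous_const.sub (continuous_ofReal_realPart.comp
          ((continuous_character_left k).smul continuous_const))).norm).pow 2
      simpa using hc.tendsto x

theorem twoPoint_waveField (hv : ∀ i, StronglyMeasurable (v i)) (hv2 : ∀ i, MemLp (v i) 2 μ)
    (x y : Space d) : twoPoint (uniformMixture.{w} ι μ) (asComplex (waveField.{w} v)) x y =
      (Fintype.card ι : ℝ)⁻¹ • ∫ k, ∑ i, InnerProductSpace.rankOne ℂ
        (ofReal (realPart (character y k • v i k)))
        (ofReal (realPart (character x k • v i k))) ∂μ := by
  have hi : ∀ i, Integrable (fun k => InnerProductSpace.rankOne ℂ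
        (ofReal (realPart (character y k • v i k)))
        (ofReal (realPart (character x k • v i k)))) μ := fun i =>
    integrable_rankOne (memLp_wave hv hv2 x i) (memLp_wave hv hv2 y i)
  rw [twoPoint, integral_uniformMixture hi, integral_finsetSum _ fun i _ => hi i]
  rfl

variable {F : VectorMeasure (Space d) (Complexification U →L[ℂ] Complexification U)}

/-- The Fourier transform of a vector measure with density, as a Bochner integral. -/
theorem fourier_withDensity {f : Space d → Complexification U →L[ℂ] Complexification U}
    [IsFiniteMeasure μ] (hf : Integrable f μ) (x : Space d) :
    Integrable (fun k => character x k • f k) μ ∧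
      fourier (μ.withDensityᵥ f) x = ∫ k, character x k • f k ∂μ := by
  have hi : Integrable (fun k => character x k • f k) μ := by
    refine hf.mono ((continuous_character x).aestronglyMeasurable.smul hf.1)
      (ae_of_all _ fun k => ?_)
    rw [norm_smul, norm_character, one_mul]
  have : FiniteDimensional ℝ (Complexification U →L[ℂ] Complexification U) :=
    FiniteDimensional.trans ℝ ℂ _
  have := isFiniteMeasure_variation (μ.withDensityᵥ f)
  exact ⟨hi, integral_withDensity hf _ (integrable_character _ x)⟩

/-- A nonnegative density `f` is, up to a constant factor, a finite sum of rank one densities, with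
at least one term. The amplitudes are `√f(k) w_j`, where `w_0 = 0` and `w_1, …, w_m` is an
orthonormal basis of `cU`; the extra vector provides the one term needed if `U` is trivial. -/
theorem exists_amplitude {f : Space d → Complexification U →L[ℂ] Complexification U}
    (hf : StronglyMeasurable f) (h0 : ∀ k, 0 ≤ f k) (hfi : Integrable f μ) :
    ∃ (m : ℕ) (q : Fin (m + 1) → Space d → Complexification U),
      (∀ j, StronglyMeasurable (q j)) ∧ (∀ j, MemLp (q j) 2 μ) ∧
      ∀ k, ∑ j, InnerProductSpace.rankOne ℂ (q j k) (q j k) = (2 * (m + 1) : ℝ) • f k := by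
  let e := stdOrthonormalBasis ℂ (Complexification U)
  let m := Module.finrank ℂ (Complexification U)
  let w : Fin (m + 1) → Complexification U := Fin.cons 0 e
  let c : ℝ := √(2 * (m + 1))
  have hc : c * c = 2 * (m + 1) := Real.mul_self_sqrt (by positivity)
  let q : Fin (m + 1) → Space d → Complexification U := fun j k => (c : ℂ) • CFC.sqrt (f k) (w j)
  have hq : ∀ j, StronglyMeasurable (q j) := fun j =>
    ((ContinuousLinearMap.apply ℂ _ (w j)).continuous.comp_stronglyMeasurable
      (stronglyMeasurable_sqrt hf h0)).const_smul (c : ℂ)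
  refine ⟨m, q, hq, fun j => ?_, fun k => ?_⟩
  · rw [memLp_two_iff_integrable_sq_norm (hq j).aestronglyMeasurable]
    refine Integrable.mono' (hfi.norm.const_mul (c ^ 2 * ‖w j‖ ^ 2))
      ((hq j).aestronglyMeasurable.norm.pow 2) (ae_of_all _ fun k => ?_)
    have h1 : ‖CFC.sqrt (f k)‖ ^ 2 = ‖f k‖ := by
      rw [CFC.norm_sqrt _ (h0 k), Real.sq_sqrt (norm_nonneg _)]
    rw [Real.norm_of_nonneg (by positivity)]
    calc ‖q j k‖ ^ 2 = c ^ 2 * ‖CFC.sqrt (f k) (w j)‖ ^ 2 := by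
          simp only [q, norm_smul, Complex.norm_real, Real.norm_eq_abs, mul_pow, sq_abs]
      _ ≤ c ^ 2 * (‖CFC.sqrt (f k)‖ * ‖w j‖) ^ 2 := by
        gcongr
        exact (CFC.sqrt (f k)).le_opNorm _
      _ = _ := by rw [← h1]; ring
  · have h1 : ∀ j, InnerProductSpace.rankOne ℂ (q j k) (q j k) = (2 * (m + 1) : ℝ) •
        InnerProductSpace.rankOne ℂ (CFC.sqrt (f k) (w j)) (CFC.sqrt (f k) (w j)) := fun j => by
      simp only [q, map_smul, map_smulₛₗ, smul_apply, Complex.conj_ofReal, smul_smul]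
      rw [← Complex.ofReal_mul, hc, Complex.coe_smul]
    simp_rw [h1]
    rw [← Finset.smul_sum, Fin.sum_univ_succ]
    simp only [w, Fin.cons_zero, Fin.cons_succ, map_zero, zero_add]
    rw [← eq_sum_rankOne_sqrt e (h0 k)]

theorem integral_add_conjOp [IsFiniteMeasure μ]
    {f : Space d → Complexification U →L[ℂ] Complexification U} (hfi : Integrable f μ)
    (x : Space d) :
    ∫ k, (character x k • f k + conjOpCLM (character x k • f k)) ∂μ =
      fourier (μ.withDensityᵥ f) x + conjOp (fourier (μ.withDensityᵥ f) x) := by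
  obtain ⟨hi, hF⟩ := fourier_withDensity hfi x
  rw [integral_add hi (conjOpCLM.integrable_comp hi), conjOpCLM.integral_comp_comm hi, ← hF,
    conjOpCLM_apply]

theorem twoPoint_withPhases [IsFiniteMeasure μ]
    {f : Space d → Complexification U →L[ℂ] Complexification U} (hfi : Integrable f μ) {m : ℕ}
    {q : Fin (m + 1) → Space d → Complexification U} (hq : ∀ j, StronglyMeasurable (q j))
    (hq2 : ∀ j, MemLp (q j) 2 μ)
    (hf : ∀ k, ∑ j, InnerProductSpace.rankOne ℂ (q j k) (q j k) = (2 * (m + 1) : ℝ) • f k)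
    (x y : Space d) :
    twoPoint (uniformMixture.{w} (Fin (m + 1) × Fin 4) μ)
      (asComplex (waveField.{w} (withPhases q))) x y =
      (1 / 2 : ℝ) • (fourier (μ.withDensityᵥ f) (y - x) +
        conjOp (fourier (μ.withDensityᵥ f) (y - x))) := by
  rw [twoPoint_waveField (stronglyMeasurable_withPhases hq) (memLp_withPhases hq2)]
  simp_rw [withPhases, fun k => sum_rankOne_wave (hf k) x y k]
  rw [integral_smul, integral_add_conjOp hfi, Fintype.card_prod, Fintype.card_fin,
    Fintype.card_fin]
  have hm : (((m + 1) * 4 : ℕ) : ℝ)⁻¹ * (2 * (m + 1)) = 1 / 2 := by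
    push_cast
    field_simp
    norm_num
  rw [← hm]
  exact (mul_smul _ _ _).symm

/-- If the values of `F` are nonnegative and its Fourier transform is real, then `F` is the spectral
measure of a real field, namely of `x ↦ re (i^s exp (i (k, x)) q_j(k))`, where the wavevector `k`,
the index `j` and the phase `s = 0, 1, 2, 3` are independent. -/
theorem exists_waveField (hpos : ∀ A, MeasurableSet A → (F A).IsPositive)
    (hconj : ∀ x, conjOp (fourier F x) = fourier F x) :
    ∃ (Ω : Type w) (_ : MeasurableSpace Ω) (P : Measure Ω) (_ : IsProbabilityMeasure P)
      (S : Space d → Ω → U), IsCentredField P (asComplex S) ∧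
        IsSpectralMeasure P (asComplex S) F := by
  obtain ⟨μ, hprob, f, hf, h0, hfi, hF⟩ := exists_nonneg_density F hpos
  obtain ⟨m, q, hq, hq2, hqf⟩ := exists_amplitude hf h0 hfi
  refine ⟨_, inferInstance, uniformMixture.{w} (Fin (m + 1) × Fin 4) μ, inferInstance,
    waveField.{w} (withPhases q), isCentredField_waveField (stronglyMeasurable_withPhases hq)
      (memLp_withPhases hq2) (sum_withPhases q), ?_⟩
  rw [isSpectralMeasure_iff]
  intro x y
  rw [twoPoint_withPhases hfi hq hq2 hqf, ← hF, hconj, ← two_smul ℝ, smul_smul]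
  norm_num

end Construction

end

end RandomFieldSpectrum

/-! ### Spectral characterization of homogeneous and isotropic fields -/

theorem mainTheorem3 {d : ℕ} (hd : 0 < d)
    {U : Type v} [NormedAddCommGroup U] [InnerProductSpace ℝ U] [FiniteDimensional ℝ U]
    (G : Subgroup (Orth d)) (hG : IsClosed (G : Set (Orth d)))
    (θ : G →* (U ≃ₗᵢ[ℝ] U)) (hθ : Continuous fun p : G × U => θ p.1 p.2)
    (hI : ∀ h : (-1 : Orth d) ∈ G, tensorSq θ ⟨-1, h⟩ = LinearMap.id)
    (F : VectorMeasure (Space d) (Complexification U →L[ℂ] Complexification U)) :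
    ((∃ (Ω : Type u) (_ : MeasurableSpace Ω) (P : Measure Ω) (_ : IsProbabilityMeasure P)
        (S : Space d → Ω → U), IsCentredField P (asComplex S) ∧ IsHomogeneous P (asComplex S) ∧
          IsIsotropic θ P (asComplex S) ∧ IsSpectralMeasure P (asComplex S) F) ↔
      (TakesTildeValues G F ∧ IsTildeEquivariant θ F)) ∧
    ∀ {Ω : Type u} [MeasurableSpace Ω] (P : Measure Ω) [IsProbabilityMeasure P]
      (T : Space d → Ω → Complexification U), IsCentredField P T → IsSpectralMeasure P T F →
        ((IsUValued P T ∧ IsHomogeneous P T ∧ IsIsotropic θ P T) ↔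
          (TakesTildeValues G F ∧ IsTildeEquivariant θ F)) := by
  have hpos : TakesTildeValues G F → ∀ A, MeasurableSet A → (F A).IsPositive :=
    fun h A hA => (h A hA).2
  have hmp : ∀ {Ω : Type u} [MeasurableSpace Ω] (P : Measure Ω)
      (T : Space d → Ω → Complexification U), IsCentredField P T → IsSpectralMeasure P T F →
      IsUValued P T → IsIsotropic θ P T → TakesTildeValues G F ∧ IsTildeEquivariant θ F := by
    rintro Ω _ P T hT hF ⟨Ω', _, P', _, S, hS, hST⟩ hiso
    have hA : RandomFieldSpectrum.IsAdmissible θ F :=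
      RandomFieldSpectrum.isAdmissible_of_isSpectralMeasure hT hF
        (fun x y => by rw [← hST, RandomFieldSpectrum.conjOp_twoPoint_asComplex hS]) hiso
    exact ⟨hA.takesTildeValues hI, hA.isTildeEquivariant⟩
  refine ⟨⟨?_, fun h => ?_⟩, fun P _ T hT hF => ⟨fun h => hmp P T hT hF h.1 h.2.2, fun h => ?_⟩⟩
  · rintro ⟨Ω, _, P, _, S, hS, -, hiso, hF⟩
    exact hmp P (asComplex S) hS hF ⟨Ω, _, P, inferInstance, S, hS, fun _ _ => rfl⟩ hiso
  · have hA := RandomFieldSpectrum.IsAdmissible.of_tilde hI h.1 h.2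
    obtain ⟨Ω, _, P, _, S, hS, hSF⟩ :=
      RandomFieldSpectrum.exists_waveField.{u} (hpos h.1) hA.conjOp_fourier
    obtain ⟨hhom, hiso⟩ := hA.isHomogeneous_and_isIsotropic hS hSF
    exact ⟨Ω, _, P, inferInstance, S, hS, hhom, hiso, hSF⟩
  · have hA := RandomFieldSpectrum.IsAdmissible.of_tilde hI h.1 h.2
    obtain ⟨Ω, _, P', _, S, hS, hSF⟩ :=
      RandomFieldSpectrum.exists_waveField.{u} (hpos h.1) hA.conjOp_fourier
    exact ⟨⟨Ω, _, P', inferInstance, S, hS, fun x y => (hSF x y).trans (hF x y).symm⟩,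
      hA.isHomogeneous_and_isIsotropic hT hF⟩
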